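/- **Setting.** A *marked directed graph* is a directed multigraph $G$ (loops and multiple edges allowed) with finite or countable vertex set, in which every vertex $i$ has finite in-degree and carries an integer mark $m_i$ with $d^{(\mathrm{out})}_i\le m_i<\infty$. For a rooted marked directed graph $(G,\varnothing,M(G))$ and $k\ge1$, the $k$-neighborhood $U_{\le k}(\varnothing)$ is the subgraph induced by the vertices from which $\varnothing$ can be reached by a directed path of at most $k$ edges, rooted at $\varnothing$ and with the original marks. Isomorphisms are bijections of the vertex sets preserving edges with multiplicities, roots and marks. The local distance is $d_{loc}=1/(1+\kappa)$, where $\kappa\in\{1,2,\dots\}\cup\{\infty\}$ is the smallest $k\ge1$ for which the $k$-neighborhoods of the two roots are not isomorphic ($d_{loc}=0$ if there is none), and $\tilde{\mathcal G}_\star$ is the metric space of rooted marked directed graphs with graphs at distance $0$ identified, equipped with its Borel $\sigma$-algebra. Random finite marked directed graphs $G_n$ *converge in probability in the directed local weak sense* to a probability measure $\mathcal P$ on $\tilde{\mathcal G}_\star$ if, for every bounded continuous $f:\tilde{\mathcal G}_\star\to\mathbb R$, $$\frac1{|V(G_n)|}\sum_{i\in V(G_n)} f(G_n,i,M(G_n))\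 \longrightarrow\ \mathbb E_{\mathcal P}[f]\quad\text{in probability}.$$ **Model.** For each $n$ let $(D^{(\mathrm{out})}_i,D^{(\mathrm{in})}_i)_{i\in[n]}$ (depending on $n$) be nonnegative integers with $L_n:=\sum_{i\in[n]}D^{(\mathrm{out})}_i=\sum_{i\in[n]}D^{(\mathrm{in})}_i$. The directed configuration model $\mathrm{DCM}_n$ is the random directed multigraph on $[n]$ obtained by giving each vertex $i$ exactly $D^{(\mathrm{out})}_i$ outgoing and $D^{(\mathrm{in})}_i$ incoming half-edges and pairing the outgoing with the incoming half-edges by a uniformly random bijection; the mark of $i$ is its out-degree $D^{(\mathrm{out})}_i$. **Proposition 6.2.** Suppose that there is a probability distribution $(p(h,l))_{h,l\ge0}$, the law of a pair $(\mathcal D^{(\mathrm{out})},\mathcal D^{(\mathrm{in})})$, such that, as $n\to\infty$, (a) $\frac1n\sum_{i\in[n]}\mathbf 1\{D^{(\mathrm{out})}_i=h,\,D^{(\mathrm{in})}_i=l\}\to p(h,l)$ for all $h,l\ge0$; (b) $\frac1n\sum_{i\in[n]}D^{(\mathrm{out})}_i\to\mathbb E[\mathcal D^{(\mathrm{out})}]$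 and $\frac1n\sum_{i\in[n]}D^{(\mathrm{in})}_i\to\mathbb E[\mathcal D^{(\mathrm{in})}]$, where $0<\mathbb E[\mathcal D^{(\mathrm{out})}]=\mathbb E[\mathcal D^{(\mathrm{in})}]<\infty$; (c) $\sum_{i\in[n]}\frac{h}{L_n}\mathbf 1\{D^{(\mathrm{out})}_i=h,\,D^{(\mathrm{in})}_i=l\}\to p^\star(h,l):=\frac{h}{\mathbb E[\mathcal D^{(\mathrm{out})}]}\,p(h,l)$ for all $h,l\ge0$. Then $\mathrm{DCM}_n$ converges in probability in the directed local weak sense to the law $\mathcal P$ of the marked Galton–Watson tree, rooted at its ancestor, in which edges are directed from children to parents; the pair (mark, in-degree), i.e. (mark, number of children), of the root has law $p$, that of every other vertex has law $p^\star$, and these pairs are independent across the vertices of the tree. -/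

import Mathlib

open MeasureTheory Filter Topology
open scoped ENNReal BoundedContinuousFunction

noncomputable section

namespace DirectedLW

/-! ### Marked directed multigraphs -/

/-- A marked, locally finite directed multigraph on the vertex set `V`: `mult i j` is the number
of edges from `i` to `j` (loops and multiple edges are allowed), every in-degree is finite, and
every vertex carries a finite integer mark which is at least its out-degree. -/
structure MarkedDigraph (V : Type) where
  mult : V → V → ℕ
  mark : V → ℕ
  inDegree_lt_top : ∀ i, ∑' j, (mult j i : ℝ≥0∞) < ⊤
  outDegree_le_mark : ∀ i, ∑' j, (mult i j : ℝ≥0∞) ≤ mark i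

/-- A rooted marked directed multigraph, with a finite or countable vertex set. -/
structure RootedMarkedDigraph : Type 1 where
  V : Type
  countable : Countable V
  graph : MarkedDigraph V
  root : V

/-- Isomorphism: a bijection of the vertices which preserves the edges with their multiplicities,
the root and the marks. -/
def Isomorphic (G H : RootedMarkedDigraph) : Prop :=
  ∃ γ : G.V ≃ H.V, (∀ i j, H.graph.mult (γ i) (γ j) = G.graph.mult i j) ∧
    γ G.root = H.root ∧ ∀ i, H.graph.mark (γ i) = G.graph.mark i

/-- The vertices found in the first `k` steps of the exploration from the root, in which the
incoming edges are explored against their direction. -/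
def RootedMarkedDigraph.found (G : RootedMarkedDigraph) : ℕ → Set G.V
  | 0 => {G.root}
  | k + 1 => G.found k ∪ {j | ∃ i ∈ G.found k, G.graph.mult j i ≠ 0}

lemma RootedMarkedDigraph.root_mem_found (G : RootedMarkedDigraph) (k : ℕ) :
    G.root ∈ G.found k := by
  induction k with
  | zero => exact Set.mem_singleton _
  | succ k ih => exact Or.inl ih

/-- The `k`-neighbourhood of the root: the vertices found in the first `k` steps with their
original marks, and all the edges between them (no edges for `k = 0`). -/
def RootedMarkedDigraph.nbhd (G : RootedMarkedDigraph) (k : ℕ) : RootedMarkedDigraph where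
  V := G.found k
  countable := by
    have := G.countable
    infer_instance
  graph :=
    { mult := fun i j => if k = 0 then 0 else G.graph.mult i j
      mark := fun i => G.graph.mark i
      inDegree_lt_top := fun i => by
        refine lt_of_le_of_lt (le_trans (ENNReal.tsum_le_tsum fun j => ?_)
          (ENNReal.tsum_comp_le_tsum_of_injective (f := ((↑) : G.found k → G.V))
            Subtype.val_injective fun j => (G.graph.mult j i : ℝ≥0∞)))
          (G.graph.inDegree_lt_top i)
        split_ifs <;> simp
      outDegree_le_mark := fun i => by
        refine le_trans (le_trans (ENNReal.tsum_le_tsum fun j => ?_)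
          (ENNReal.tsum_comp_le_tsum_of_injective (f := ((↑) : G.found k → G.V))
            Subtype.val_injective fun j => (G.graph.mult i j : ℝ≥0∞)))
          (G.graph.outDegree_le_mark i)
        split_ifs <;> simp }
  root := ⟨G.root, G.root_mem_found k⟩

/-! ### The local distance -/

lemma Isomorphic.refl (G : RootedMarkedDigraph) : Isomorphic G G :=
  ⟨Equiv.refl _, fun _ _ => rfl, rfl, fun _ => rfl⟩

lemma Isomorphic.symm {G H : RootedMarkedDigraph} (h : Isomorphic G H) : Isomorphic H G := by
  obtain ⟨γ, h1, h2, h3⟩ := h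
  refine ⟨γ.symm, fun i j => ?_, ?_, fun i => ?_⟩
  · rw [← h1, γ.apply_symm_apply, γ.apply_symm_apply]
  · rw [← h2, γ.symm_apply_apply]
  · rw [← h3, γ.apply_symm_apply]

lemma Isomorphic.trans {G H K : RootedMarkedDigraph} (h : Isomorphic G H)
    (h' : Isomorphic H K) : Isomorphic G K := by
  obtain ⟨γ, h1, h2, h3⟩ := h
  obtain ⟨δ, k1, k2, k3⟩ := h'
  refine ⟨γ.trans δ, fun i j => ?_, ?_, fun i => ?_⟩
  · simp [k1, h1]
  · simp [h2, k2]
  · simp [k3, h3]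

/-- The radii `k ≥ 1` at which the neighbourhoods of the two roots are not isomorphic. -/
def badRadii (G H : RootedMarkedDigraph) : Set ℕ :=
  {k | 1 ≤ k ∧ ¬ Isomorphic (G.nbhd k) (H.nbhd k)}

open Classical in
/-- The local distance `1 / (1 + κ)`, with `κ` the smallest radius at which the neighbourhoods
are not isomorphic; it is `0` if there is no such radius (`κ = ∞`). -/
def locDist (G H : RootedMarkedDigraph) : ℝ :=
  if badRadii G H = ∅ then 0 else 1 / (1 + (sInf (badRadii G H) : ℕ))

lemma badRadii_self (G : RootedMarkedDigraph) : badRadii G G = ∅ :=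
  Set.eq_empty_of_forall_notMem fun _ hk => hk.2 (Isomorphic.refl _)

lemma badRadii_comm (G H : RootedMarkedDigraph) : badRadii G H = badRadii H G := by
  ext k
  exact ⟨fun h => ⟨h.1, fun h' => h.2 h'.symm⟩, fun h => ⟨h.1, fun h' => h.2 h'.symm⟩⟩

lemma locDist_nonneg (G H : RootedMarkedDigraph) : 0 ≤ locDist G H := by
  unfold locDist
  split_ifs
  · exact le_rfl
  · positivity

lemma le_locDist {G H : RootedMarkedDigraph} {k : ℕ} (hk : k ∈ badRadii G H) :
    1 / (1 + (k : ℝ)) ≤ locDist G H := by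
  unfold locDist
  rw [if_neg (Set.Nonempty.ne_empty ⟨k, hk⟩)]
  have h : sInf (badRadii G H) ≤ k := Nat.sInf_le hk
  gcongr

lemma locDist_triangle (G H K : RootedMarkedDigraph) :
    locDist G K ≤ locDist G H + locDist H K := by
  by_cases h : badRadii G K = ∅
  · have h0 : locDist G K = 0 := if_pos h
    rw [h0]
    exact add_nonneg (locDist_nonneg _ _) (locDist_nonneg _ _)
  · have hmem := Nat.sInf_mem (Set.nonempty_iff_ne_empty.2 h)
    have h0 : locDist G K = 1 / (1 + (sInf (badRadii G K) : ℕ)) := if_neg h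
    rw [h0]
    by_cases h1 : Isomorphic (G.nbhd (sInf (badRadii G K))) (H.nbhd (sInf (badRadii G K)))
    · refine (le_locDist ⟨hmem.1, fun h2 => hmem.2 (h1.trans h2)⟩).trans ?_
      exact le_add_of_nonneg_left (locDist_nonneg _ _)
    · refine (le_locDist ⟨hmem.1, h1⟩).trans ?_
      exact le_add_of_nonneg_right (locDist_nonneg _ _)

instance : PseudoMetricSpace RootedMarkedDigraph where
  dist := locDist
  dist_self G := if_pos (badRadii_self G)
  dist_comm G H := by
    unfold locDist
    rw [badRadii_comm]
  dist_triangle := locDist_triangle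

/-- The metric space of rooted marked directed graphs in which graphs at local distance zero are
identified (isomorphic graphs are at distance zero). -/
abbrev LocalSpace : Type 1 := SeparationQuotient RootedMarkedDigraph

instance : MeasurableSpace LocalSpace := borel LocalSpace

instance : BorelSpace LocalSpace := ⟨rfl⟩

/-! ### Local weak convergence -/

/-- The class of the marked graph `G` rooted at `i`. -/
def MarkedDigraph.rootedAt {V : Type} [Countable V] (G : MarkedDigraph V) (i : V) : LocalSpace :=
  SeparationQuotient.mk ⟨V, ‹Countable V›, G, i⟩

/-- The law of a finite marked graph `G` with a uniformly chosen root,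
`(1 / |V|) ∑ i, δ_{(G, i)}`. -/
def MarkedDigraph.rootLaw {V : Type} [Fintype V] (G : MarkedDigraph V) : Measure LocalSpace :=
  (Fintype.card V : ℝ≥0∞)⁻¹ • ∑ i, Measure.dirac (G.rootedAt i)

/-- Convergence in probability in the directed local weak sense, for random finite marked graphs
`G n` defined on probability spaces `(Ω n, Q n)`: for every bounded continuous `f` on the space of
rooted marked graphs, the random variable `E_{P_n} f` converges in probability to the
constant `E_P f`, where `P_n` is the law of `G n` with a uniformly chosen root. -/
def ConvergesInProbability {Ω : ℕ → Type} [∀ n, MeasurableSpace (Ω n)] (Q : ∀ n, Measure (Ω n))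
    {V : ℕ → Type} [∀ n, Fintype (V n)] (G : ∀ n, Ω n → MarkedDigraph (V n))
    (P : Measure LocalSpace) : Prop :=
  IsProbabilityMeasure P ∧ ∀ f : LocalSpace →ᵇ ℝ, ∀ ε : ℝ, 0 < ε →
    Tendsto (fun n => Q n {ω | ε ≤ |∫ x, f x ∂(G n ω).rootLaw - ∫ x, f x ∂P|}) atTop (𝓝 0)

/-! ### The directed configuration model -/

/-- The pairings of the outgoing half-edges `(i, a)`, `a < dout i`, with the incoming half-edges
`(j, b)`, `b < din j`. -/
abbrev Pairing {V : Type} (dout din : V → ℕ) : Type :=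
  (Σ i, Fin (dout i)) ≃ (Σ j, Fin (din j))

instance {V : Type} (dout din : V → ℕ) : MeasurableSpace (Pairing dout din) := ⊤

/-- The uniform distribution on the pairings. -/
def pairingMeasure {V : Type} (dout din : V → ℕ) : Measure (Pairing dout din) :=
  ProbabilityTheory.uniformOn Set.univ

/-- The marked directed multigraph given by a pairing of the half-edges; the marks are the
out-degrees. -/
def configGraph {V : Type} [Fintype V] [DecidableEq V] {dout din : V → ℕ}
    (σ : Pairing dout din) : MarkedDigraph V where
  mult i j := (Finset.univ.filter fun a : Fin (dout i) => (σ ⟨i, a⟩).1 = j).card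
  mark i := dout i
  inDegree_lt_top i := by
    rw [tsum_fintype]
    exact ENNReal.sum_lt_top.2 fun _ _ => ENNReal.natCast_lt_top _
  outDegree_le_mark i := by
    rw [tsum_fintype, ← Nat.cast_sum, ← Finset.card_eq_sum_card_fiberwise
      (f := fun a : Fin (dout i) => (σ ⟨i, a⟩).1) (fun _ _ => Finset.mem_coe.2 (Finset.mem_univ _))]
    simp

/-! ### Regularity of the bi-degree sequence -/

/-- The mean of the first coordinate (the out-degree). -/
def meanOut (p : PMF (ℕ × ℕ)) : ℝ≥0∞ := ∑' x, (x.1 : ℝ≥0∞) * p x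

/-- The mean of the second coordinate (the in-degree). -/
def meanIn (p : PMF (ℕ × ℕ)) : ℝ≥0∞ := ∑' x, (x.2 : ℝ≥0∞) * p x

/-- The bi-degree regularity conditions, with limiting law `p` of (out-degree, in-degree). -/
structure BidegreeRegular (dout din : ∀ n : ℕ, Fin n → ℕ) (p : PMF (ℕ × ℕ)) : Prop where
  tendsto_bidegree : ∀ h l : ℕ,
    Tendsto (fun n : ℕ =>
        (1 / (n : ℝ)) * ∑ i, if dout n i = h ∧ din n i = l then (1 : ℝ) else 0)
      atTop (𝓝 (p (h, l)).toReal)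
  meanOut_ne_zero : meanOut p ≠ 0
  meanOut_ne_top : meanOut p ≠ ⊤
  tendsto_meanOut :
    Tendsto (fun n : ℕ => (1 / (n : ℝ)) * ∑ i, (dout n i : ℝ)) atTop (𝓝 (meanOut p).toReal)
  tendsto_meanIn :
    Tendsto (fun n : ℕ => (1 / (n : ℝ)) * ∑ i, (din n i : ℝ)) atTop (𝓝 (meanIn p).toReal)
  meanIn_eq : meanIn p = meanOut p
  tendsto_sizeBiased : ∀ h l : ℕ,
    Tendsto (fun n : ℕ => ∑ i, if dout n i = h ∧ din n i = l then
        (h : ℝ) / ((∑ k, dout n k : ℕ) : ℝ) else 0)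
      atTop (𝓝 ((h : ℝ) / (meanOut p).toReal * (p (h, l)).toReal))

/-- The law `p⋆(h, l) = h p(h, l) / ∑ (h', l'), h' p(h', l')`, size-biased by the out-degree. -/
def sizeBiasedOut (p : PMF (ℕ × ℕ)) (h0 : meanOut p ≠ 0) (htop : meanOut p ≠ ⊤) :
    PMF (ℕ × ℕ) :=
  PMF.normalize (fun x => (x.1 : ℝ≥0∞) * p x) h0 htop

lemma sizeBiasedOut_apply (p : PMF (ℕ × ℕ)) (h0 : meanOut p ≠ 0) (htop : meanOut p ≠ ⊤)
    (x : ℕ × ℕ) : sizeBiasedOut p h0 htop x = (x.1 : ℝ≥0∞) * p x * (meanOut p)⁻¹ := rfl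

/-! ### The marked Galton–Watson tree -/

/-- A word in the alphabet `ℕ` stands for an individual of the family tree: `[]` is the root, and
`j :: v` is the child number `j` of `v`. The individual `v` has the label `x v = (mark, number of
children)`. This predicate tells which individuals exist. -/
def IsIndividual (x : List ℕ → ℕ × ℕ) : List ℕ → Prop
  | [] => True
  | j :: v => IsIndividual x v ∧ j < (x v).2

/-- The family tree of the labels `x`, with an edge from each child to its parent. The mark of `v`
is `(x v).1`; in order that every family of labels gives a marked graph, the mark `0` of a child is
replaced by `1` (in the Galton–Watson tree below this has probability zero, since the size-biased
law does not charge the mark `0`). -/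
def familyTree (x : List ℕ → ℕ × ℕ) : RootedMarkedDigraph where
  V := {v : List ℕ // IsIndividual x v}
  countable := inferInstance
  graph :=
    { mult := fun u v => if u.1 ≠ [] ∧ u.1.tail = v.1 then 1 else 0
      mark := fun v => if v.1 = [] then (x v.1).1 else max 1 (x v.1).1
      inDegree_lt_top := fun v => by
        have hfin : {u : {w : List ℕ // IsIndividual x w} | u.1 ≠ [] ∧ u.1.tail = v.1}.Finite := by
          refine Set.Finite.of_finite_image (f := fun u => u.1.headI)
            ((Set.finite_Iio (x v.1).2).subset ?_) ?_
          · rintro _ ⟨⟨_ | ⟨j, w⟩, hu⟩, ⟨h1, h2⟩, rfl⟩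
            · exact absurd rfl h1
            · have h2' : w = v.1 := h2
              exact h2' ▸ hu.2
          · rintro ⟨_ | ⟨j, w⟩, hu⟩ ⟨h1, h2⟩ ⟨_ | ⟨j', w'⟩, hu'⟩ ⟨h1', h2'⟩ h
            · rfl
            · exact absurd rfl h1
            · exact absurd rfl h1'
            · simp_all
        rw [tsum_eq_sum (s := hfin.toFinset)]
        · exact ENNReal.sum_lt_top.2 fun _ _ => ENNReal.natCast_lt_top _
        · intro u hu
          rw [Set.Finite.mem_toFinset, Set.mem_ofPred_eq] at hu
          rw [if_neg hu, Nat.cast_zero]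
      outDegree_le_mark := fun u => by
        obtain ⟨_ | ⟨j, w⟩, hu⟩ := u
        · simp
        · rw [tsum_eq_single (⟨w, hu.1⟩ : {v : List ℕ // IsIndividual x v})]
          · simp
          · intro v hv
            rw [if_neg fun h => hv (Subtype.ext h.2.symm), Nat.cast_zero] }
  root := ⟨[], trivial⟩

/-- The law of the labels: independent, with law `p` at the root and law `q` elsewhere. -/
def labelLaw (p q : PMF (ℕ × ℕ)) : Measure (List ℕ → ℕ × ℕ) :=
  Measure.infinitePi fun v : List ℕ => (if v = [] then p else q).toMeasure

/-- The law of the marked Galton–Watson tree with edges directed from children to parents, in which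
(mark, in-degree) has law `p` at the root and law `q` at every other vertex, independently. -/
def galtonWatsonLaw (p q : PMF (ℕ × ℕ)) : Measure LocalSpace :=
  (labelLaw p q).map fun x => SeparationQuotient.mk (familyTree x)

end DirectedLW

end

open MeasureTheory Filter Topology
open scoped ENNReal BoundedContinuousFunction

noncomputable section

namespace DirectedLW

/-! ### Counting pairings -/

/-! The proof is a second-moment argument for tree counts, followed by an approximation of bounded
continuous functions by finitely many trees.

Fix labels `x` and a depth `k`. An embedding of the truncated family tree into a configuration is an
injective, label-preserving placement of its vertices in which every child is joined by an
out-half-edge to the in-half-edge of its parent that carries its birth number. A tree with `m` edges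
has `m + 1` vertices. There are about `n ^ (m + 1) ∏ p` placements of the vertices, and each is
realised with probability (product of the out-degrees of the children) / `(L_n)_m`, with `L_n ~ n
E[D]`. So the mean number of embeddings is about `n P`, where `P` has a factor `p` for each vertex
and a further factor out-degree / mean for each non-root vertex. This is where the size-biased law
arises: `P` is the Galton–Watson probability of the cylinder of `x` (`tendsto_mean_embeddings`,
`labelLaw_sizeBiasedOut_cyl`).

Two disjoint copies of the tree form a pattern of the same kind, with mean number of embeddings
about `n² P²`. Two matched roots whose trees overlap are rare: from a common vertex the second root
is reached by boundedly many forward paths, as all marks on the trees are prescribed by `x`. So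
there are only `O(n)` overlapping pairs (`card_matchedRoots_sq_le`), and Chebyshev's inequality
gives concentration of the proportion of matched roots (`tendsto_matchedRoots`).

Finally, for a bounded continuous `f`, finitely many disjoint cylinders carry nearly all the
Galton–Watson mass and nearly determine `f` (`exists_finset_trees`). Their proportions in the graph
converge, hence the vertices outside them are also few, and both integrals are close to the same
finite sum. No separate tightness argument for the graphs is needed. -/

/-- The permutations of `B` act transitively on the injections `T → B`, so that all fibres of the
restriction map below have equal size. -/
lemma exists_perm_comp_eq {T B : Type*} [Finite T] [Finite B] {g g' : T → B}
    (hg : g.Injective) (hg' : g'.Injective) : ∃ π : Equiv.Perm B, ∀ t, π (g t) = g' t := by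
  classical
  let e : {b // b ∈ Set.range g} ≃ {b // b ∈ Set.range g'} :=
    (Equiv.ofInjective g hg).symm.trans (Equiv.ofInjective g' hg')
  refine ⟨e.extendSubtype, fun t => ?_⟩
  rw [Equiv.extendSubtype_apply_of_mem e (g t) ⟨t, rfl⟩]
  have : (⟨g t, t, rfl⟩ : {b // b ∈ Set.range g}) = Equiv.ofInjective g hg t := rfl
  simp only [e, Equiv.trans_apply, this, Equiv.symm_apply_apply]
  rfl

/-- Among all bijections `A ≃ B`, a proportion `1 / (N)_m` extends a given injection defined on `m`
points of `A`. -/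
lemma card_extensions_mul {T A B : Type*} [Fintype T] [Fintype A] [Fintype B]
    [DecidableEq A] [DecidableEq B] {f : T → A} {g : T → B}
    (hf : f.Injective) (hg : g.Injective) :
    (Finset.univ.filter fun σ : A ≃ B => ∀ t, σ (f t) = g t).card *
      (Fintype.card B).descFactorial (Fintype.card T) = Fintype.card (A ≃ B) := by
  classical
  let φ : (A ≃ B) → (T ↪ B) := fun σ => ⟨fun t => σ (f t), fun s t h => hf (σ.injective h)⟩
  -- Composition with a permutation of `B` that takes `g` to `g'` matches the two fibres of
  -- restriction along `f`.
  have hfib : ∀ g' : T ↪ B, (Finset.univ.filter fun σ => φ σ = g').card =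
      (Finset.univ.filter fun σ : A ≃ B => ∀ t, σ (f t) = g t).card := by
    intro g'
    obtain ⟨π, hπ⟩ := exists_perm_comp_eq hg g'.injective
    refine (Finset.card_equiv (Equiv.equivCongr (Equiv.refl A) π) fun σ => ?_).symm
    simp only [Finset.mem_filter, Finset.mem_univ, true_and, φ, DFunLike.ext_iff]
    refine forall_congr' fun t => ?_
    change _ ↔ π (σ (f t)) = g' t
    rw [← hπ, π.apply_eq_iff_eq]
  have h := Finset.card_eq_sum_card_fiberwise (f := φ) (s := Finset.univ) (t := Finset.univ)
    (fun _ _ => Finset.mem_coe.2 (Finset.mem_univ _))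
  simp only [hfib, Finset.sum_const, smul_eq_mul, Finset.card_univ,
    Fintype.card_embedding_eq] at h
  rw [h, mul_comm]

/-- The map `w` embeds into the configuration `σ` the pattern with vertices `W`, labels
`x = (out-degree, in-degree)`, and edges `T`, where the edge `t` leads from `src t` to the
in-half-edge number `slot t` of `tgt t`. -/
structure IsEmbedding {V W T : Type} {dout din : V → ℕ} (x : W → ℕ × ℕ) (src tgt : T → W)
    (slot : T → ℕ) (σ : Pairing dout din) (w : W → V) : Prop where
  injective : w.Injective
  label : ∀ u, (dout (w u), din (w u)) = x u
  edge : ∀ t, ∃ (a : Fin (dout (w (src t)))) (b : Fin (din (w (tgt t)))), b.1 = slot t ∧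
    σ ⟨w (src t), a⟩ = ⟨w (tgt t), b⟩

open Classical in
/-- The injective maps which preserve the labels. -/
def labelMaps {V W : Type} [Fintype V] [Fintype W] (dout din : V → ℕ) (x : W → ℕ × ℕ) :
    Finset (W → V) :=
  Finset.univ.filter fun w => w.Injective ∧ ∀ u, (dout (w u), din (w u)) = x u

open Classical in
/-- The embeddings of a pattern into a configuration. -/
def embeddings {V W T : Type} [Fintype V] [Fintype W] {dout din : V → ℕ} (x : W → ℕ × ℕ)
    (src tgt : T → W) (slot : T → ℕ) (σ : Pairing dout din) : Finset (W → V) :=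
  Finset.univ.filter fun w => IsEmbedding x src tgt slot σ w

lemma mem_embeddings {V W T : Type} [Fintype V] [Fintype W] {dout din : V → ℕ} {x : W → ℕ × ℕ}
    {src tgt : T → W} {slot : T → ℕ} {σ : Pairing dout din} {w : W → V} :
    w ∈ embeddings x src tgt slot σ ↔ IsEmbedding x src tgt slot σ w := by
  simp [embeddings]

section
variable {V W T : Type} [Fintype V] [DecidableEq V] [Fintype W] [Fintype T]
  {dout din : V → ℕ} {x : W → ℕ × ℕ} {src tgt : T → W} {slot : T → ℕ}

open Classical in
-- The in-half-edge used by an edge is prescribed, while its out-half-edge is any of those at the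
-- source. Each choice `a` of out-half-edges prescribes the pairing on `|T|` points, and different
-- choices exclude each other. `hsrc` makes the prescribed out-half-edges distinct, `htgt` the
-- in-half-edges.
lemma card_pairings_isEmbedding_mul {w : W → V} (hw : w ∈ labelMaps dout din x)
    (hsrc : src.Injective) (hslot : ∀ t, slot t < (x (tgt t)).2)
    (htgt : Function.Injective fun t => (tgt t, slot t)) :
    (Finset.univ.filter fun σ : Pairing dout din => IsEmbedding x src tgt slot σ w).card *
      (∑ i, din i).descFactorial (Fintype.card T) =
      (∏ t, (x (src t)).1) * Fintype.card (Pairing dout din) := by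
  simp only [labelMaps, Finset.mem_filter, Finset.mem_univ, true_and] at hw
  obtain ⟨hinj, hlab⟩ := hw
  have hb : ∀ t, slot t < din (w (tgt t)) := fun t => by
    have := hslot t
    rwa [← hlab] at this
  let g : T → Σ j, Fin (din j) := fun t => ⟨w (tgt t), ⟨slot t, hb t⟩⟩
  have hg : g.Injective := by
    intro s t h
    apply htgt
    simp only [g, Sigma.mk.injEq] at h
    obtain ⟨h1, h2⟩ := h
    have h1' := hinj h1
    have h3 : slot s = slot t := by
      have := (Fin.heq_ext_iff (by rw [h1])).1 h2
      simpa using this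
    exact Prod.ext h1' h3
  let f : (∀ t, Fin (dout (w (src t)))) → T → Σ i, Fin (dout i) := fun a t => ⟨w (src t), a t⟩
  have hf : ∀ a, (f a).Injective := fun a s t h => hsrc (hinj (congrArg Sigma.fst h))
  have hset : (Finset.univ.filter fun σ : Pairing dout din => IsEmbedding x src tgt slot σ w) =
      Finset.univ.biUnion fun a : ∀ t, Fin (dout (w (src t))) =>
        Finset.univ.filter fun σ : Pairing dout din => ∀ t, σ (f a t) = g t := by
    ext σ
    simp only [Finset.mem_filter, Finset.mem_univ, true_and, Finset.mem_biUnion]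
    constructor
    · intro h
      choose a b hb1 hb2 using h.edge
      refine ⟨a, fun t => ?_⟩
      rw [show f a t = ⟨w (src t), a t⟩ from rfl, hb2]
      simp only [g, Sigma.mk.injEq, heq_eq_eq, true_and]
      exact Fin.ext (hb1 t)
    · rintro ⟨a, ha⟩
      exact ⟨hinj, hlab, fun t => ⟨a t, ⟨slot t, hb t⟩, rfl, ha t⟩⟩
  have hdisj : ∀ a ∈ (Finset.univ : Finset (∀ t, Fin (dout (w (src t))))), ∀ a' ∈
      (Finset.univ : Finset (∀ t, Fin (dout (w (src t))))), a ≠ a' →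
      Disjoint (Finset.univ.filter fun σ : Pairing dout din => ∀ t, σ (f a t) = g t)
        (Finset.univ.filter fun σ : Pairing dout din => ∀ t, σ (f a' t) = g t) := by
    intro a _ a' _ hne
    rw [Finset.disjoint_filter]
    intro σ _ h1 h2
    apply hne
    funext t
    have := σ.injective ((h1 t).trans (h2 t).symm)
    simpa [f] using this
  have hcard : Fintype.card (Σ j, Fin (din j)) = ∑ i, din i := by simp
  rw [hset, Finset.card_biUnion hdisj, Finset.sum_mul, ← hcard,
    Finset.sum_congr rfl fun a _ => card_extensions_mul (hf a) hg]
  simp only [Finset.sum_const, Finset.card_univ, smul_eq_mul, Fintype.card_pi, Fintype.card_fin]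
  congr 1
  refine Finset.prod_congr rfl fun t _ => ?_
  rw [← hlab]

/-- The total number of embeddings of a pattern into all configurations. -/
lemma sum_card_embeddings_mul (hsrc : src.Injective) (hslot : ∀ t, slot t < (x (tgt t)).2)
    (htgt : Function.Injective fun t => (tgt t, slot t)) :
    (∑ σ : Pairing dout din, (embeddings x src tgt slot σ).card) *
      (∑ i, din i).descFactorial (Fintype.card T) =
    (labelMaps dout din x).card * (∏ t, (x (src t)).1) * Fintype.card (Pairing dout din) := by
  classical
  have h1 : ∀ σ : Pairing dout din, (embeddings x src tgt slot σ).card =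
      ((labelMaps dout din x).filter fun w => IsEmbedding x src tgt slot σ w).card := by
    intro σ
    congr 1
    ext w
    simp only [embeddings, labelMaps, Finset.mem_filter, Finset.mem_univ, true_and]
    exact ⟨fun h => ⟨⟨h.injective, h.label⟩, h⟩, fun h => h.2⟩
  have h2 := Finset.sum_card_bipartiteAbove_eq_sum_card_bipartiteBelow
    (fun (σ : Pairing dout din) w => IsEmbedding x src tgt slot σ w)
    (s := Finset.univ) (t := labelMaps dout din x)
  simp only [Finset.bipartiteAbove, Finset.bipartiteBelow] at h2
  simp only [h1, h2, Finset.sum_mul]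
  rw [Finset.sum_congr rfl fun w hw => card_pairings_isEmbedding_mul hw hsrc hslot htgt]
  rw [Finset.sum_const, smul_eq_mul, mul_assoc]

end

/-! ### Truncated family trees -/

/-- The individuals of the family tree of `x` up to generation `k`. -/
def levels (x : List ℕ → ℕ × ℕ) : ℕ → Finset (List ℕ)
  | 0 => {[]}
  | k + 1 => insert [] ((levels x k).biUnion fun v => (Finset.range (x v).2).image (· :: v))

lemma mem_levels {x : List ℕ → ℕ × ℕ} {k : ℕ} {v : List ℕ} :
    v ∈ levels x k ↔ IsIndividual x v ∧ v.length ≤ k := by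
  induction k generalizing v with
  | zero =>
    rcases v with _ | ⟨j, v⟩
    · simp [levels, IsIndividual]
    · simp [levels]
  | succ k ih =>
    rcases v with _ | ⟨j, v⟩
    · simp [levels, IsIndividual]
    · simp only [levels, Finset.mem_insert, Finset.mem_biUnion, Finset.mem_image, Finset.mem_range,
        List.cons.injEq, reduceCtorEq, false_or, IsIndividual, List.length_cons, ih,
        Nat.add_le_add_iff_right]
      constructor
      · rintro ⟨u, ⟨h1, h2⟩, a, h3, rfl, rfl⟩
        exact ⟨⟨h1, h3⟩, h2⟩
      · rintro ⟨⟨h1, h3⟩, h2⟩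
        exact ⟨v, ⟨h1, h2⟩, j, h3, rfl, rfl⟩

lemma nil_mem_levels (x : List ℕ → ℕ × ℕ) (k : ℕ) : [] ∈ levels x k :=
  mem_levels.2 ⟨trivial, Nat.zero_le _⟩

lemma cons_mem_levels {x : List ℕ → ℕ × ℕ} {k j : ℕ} {v : List ℕ} (h : j :: v ∈ levels x k) :
    v ∈ levels x k ∧ j < (x v).2 := by
  obtain ⟨⟨h1, h2⟩, h3⟩ := mem_levels.1 h
  exact ⟨mem_levels.2 ⟨h1, (Nat.le_succ _).trans h3⟩, h2⟩

lemma levels_mono (x : List ℕ → ℕ × ℕ) : Monotone (levels x) := fun _ _ h _ hv =>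
  mem_levels.2 ⟨(mem_levels.1 hv).1, (mem_levels.1 hv).2.trans h⟩

/-- The labels whose family tree agrees with the one of `x` up to generation `k`. -/
def cyl (k : ℕ) (x : List ℕ → ℕ × ℕ) : Set (List ℕ → ℕ × ℕ) := {y | ∀ v ∈ levels x k, y v = x v}

lemma self_mem_cyl (k : ℕ) (x : List ℕ → ℕ × ℕ) : x ∈ cyl k x := fun _ _ => rfl

lemma isIndividual_iff_of_mem_cyl {k : ℕ} {x y : List ℕ → ℕ × ℕ} (h : y ∈ cyl k x) {v : List ℕ}
    (hv : v.length ≤ k) : IsIndividual y v ↔ IsIndividual x v := by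
  induction v with
  | nil => rfl
  | cons j v ih =>
    have hv' : v.length ≤ k := (Nat.le_succ _).trans hv
    simp only [IsIndividual, ih hv']
    refine and_congr_right fun hi => ?_
    rw [h v (mem_levels.2 ⟨hi, hv'⟩)]

lemma levels_eq_of_mem_cyl {k : ℕ} {x y : List ℕ → ℕ × ℕ} (h : y ∈ cyl k x) :
    levels y k = levels x k := by
  ext v
  simp only [mem_levels]
  exact and_congr_left fun hv => isIndividual_iff_of_mem_cyl h hv

lemma mem_cyl_symm {k : ℕ} {x y : List ℕ → ℕ × ℕ} (h : y ∈ cyl k x) : x ∈ cyl k y := by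
  intro v hv
  rw [levels_eq_of_mem_cyl h] at hv
  exact (h v hv).symm

lemma mem_cyl_trans {k : ℕ} {x y z : List ℕ → ℕ × ℕ} (h : z ∈ cyl k y) (h' : y ∈ cyl k x) :
    z ∈ cyl k x := by
  intro v hv
  rw [← h' v hv]
  exact h v (by rwa [levels_eq_of_mem_cyl h'])

/-- Cylinders of the same depth are the classes of an equivalence relation: any two coincide or are
disjoint. -/
lemma cyl_eq_of_mem {k : ℕ} {x y : List ℕ → ℕ × ℕ} (h : y ∈ cyl k x) : cyl k y = cyl k x :=
  Set.Subset.antisymm (fun _ hz => mem_cyl_trans hz h) fun _ hz => mem_cyl_trans hz (mem_cyl_symm h)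

lemma isOpen_cyl (k : ℕ) (x : List ℕ → ℕ × ℕ) : IsOpen (cyl k x) := by
  have : cyl k x = ⋂ v ∈ levels x k, (fun y : List ℕ → ℕ × ℕ => y v) ⁻¹' {x v} := by
    ext y
    simp [cyl]
  rw [this]
  exact isOpen_biInter_finset fun v _ => (isOpen_discrete _).preimage (continuous_apply v)

/-- Up to generation `k` there are only countably many family trees. -/
lemma countable_range_cyl (k : ℕ) : (Set.range (cyl k)).Countable := by
  classical
  refine (Set.countable_range fun g : List ℕ →₀ ℕ × ℕ => cyl k g).mono ?_
  rintro _ ⟨x, rfl⟩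
  -- A cylinder depends only on the labels in a finite set of words, so `x` may be cut off to a
  -- finitely supported family, and those are countably many.
  refine ⟨Finsupp.onFinset (levels x k) (fun v => if v ∈ levels x k then x v else 0)
    fun v hv => by by_contra h; exact hv (if_neg h), cyl_eq_of_mem fun v hv => ?_⟩
  exact if_pos hv

lemma mem_found_zero {G : RootedMarkedDigraph} {u : G.V} : u ∈ G.found 0 ↔ u = G.root := Iff.rfl

lemma mem_found_succ {G : RootedMarkedDigraph} {k : ℕ} {u : G.V} :
    u ∈ G.found (k + 1) ↔ u ∈ G.found k ∨ ∃ i ∈ G.found k, G.graph.mult u i ≠ 0 := Iff.rfl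

lemma mem_found_familyTree (x : List ℕ → ℕ × ℕ) (k : ℕ) (v : (familyTree x).V) :
    v ∈ (familyTree x).found k ↔ v.1.length ≤ k := by
  induction k generalizing v with
  | zero =>
    rw [mem_found_zero, Nat.le_zero, List.length_eq_zero_iff]
    exact Subtype.ext_iff
  | succ k ih =>
    rw [mem_found_succ, ih]
    constructor
    · rintro (h | ⟨u, hu, h⟩)
      · omega
      · rw [ih] at hu
        have h' : v.1 ≠ [] ∧ v.1.tail = u.1 := by
          by_contra hc
          exact h (if_neg hc)
        rw [← h'.2, List.length_tail] at hu
        omega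
    · intro h
      obtain ⟨_ | ⟨j, w⟩, hv⟩ := v
      · left
        simp
      · refine Or.inr ⟨⟨w, hv.1⟩, (ih _).2 ?_, ?_⟩
        · simpa using h
        · simp [familyTree]

lemma isomorphic_nbhd_familyTree {j k : ℕ} {x y : List ℕ → ℕ × ℕ} (h : y ∈ cyl k x) (hj : j ≤ k) :
    Isomorphic ((familyTree y).nbhd j) ((familyTree x).nbhd j) := by
  have hlab : ∀ v : (familyTree y).found j, x v.1.1 = y v.1.1 := fun v =>
    mem_cyl_symm h v.1.1 (mem_levels.2
      ⟨v.1.2, ((mem_found_familyTree _ _ _).1 v.2).trans hj⟩)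
  refine ⟨⟨fun v => ⟨⟨v.1.1, (isIndividual_iff_of_mem_cyl h
      (((mem_found_familyTree _ _ _).1 v.2).trans hj)).1 v.1.2⟩,
      (mem_found_familyTree x _ _).2 ((mem_found_familyTree y _ _).1 v.2)⟩,
    fun v => ⟨⟨v.1.1, (isIndividual_iff_of_mem_cyl h
      (((mem_found_familyTree _ _ _).1 v.2).trans hj)).2 v.1.2⟩,
      (mem_found_familyTree y _ _).2 ((mem_found_familyTree x _ _).1 v.2)⟩,
    fun _ => rfl, fun _ => rfl⟩, fun _ _ => rfl, rfl, fun v => ?_⟩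
  change (if v.1.1 = [] then (x v.1.1).1 else max 1 (x v.1.1).1) =
    (if v.1.1 = [] then (y v.1.1).1 else max 1 (y v.1.1).1)
  have hv := hlab v
  simp only [hv]

lemma locDist_lt {G H : RootedMarkedDigraph} {k : ℕ}
    (h : ∀ j ≤ k, Isomorphic (G.nbhd j) (H.nbhd j)) : locDist G H < 1 / (1 + (k : ℝ)) := by
  unfold locDist
  split_ifs with h0
  · positivity
  · have hmem := Nat.sInf_mem (Set.nonempty_iff_ne_empty.2 h0)
    have hlt : k < sInf (badRadii G H) := by
      by_contra hc
      exact hmem.2 (h _ (not_lt.1 hc))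
    have : (k : ℝ) < (sInf (badRadii G H) : ℕ) := by exact_mod_cast hlt
    gcongr

/-- The cylinder of depth `k` is open in the product topology and is mapped into the ball of radius
`1 / (1 + k)`. The resulting measurability makes the push-forward in `galtonWatsonLaw` a genuine
one. -/
lemma continuous_mk_familyTree :
    Continuous fun x : List ℕ → ℕ × ℕ => (SeparationQuotient.mk (familyTree x) : LocalSpace) := by
  refine SeparationQuotient.continuous_mk.comp (continuous_iff_continuousAt.2 fun x => ?_)
  refine Metric.tendsto_nhds.2 fun ε hε => ?_
  obtain ⟨k, hk⟩ := exists_nat_one_div_lt hε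
  filter_upwards [(isOpen_cyl k x).mem_nhds (self_mem_cyl k x)] with y hy
  refine (locDist_lt fun j hj => isomorphic_nbhd_familyTree hy hj).trans ?_
  rwa [add_comm]

lemma measurable_mk_familyTree :
    Measurable fun x : List ℕ → ℕ × ℕ => (SeparationQuotient.mk (familyTree x) : LocalSpace) :=
  continuous_mk_familyTree.measurable

lemma measurableSet_cyl (k : ℕ) (x : List ℕ → ℕ × ℕ) : MeasurableSet (cyl k x) :=
  (isOpen_cyl k x).measurableSet

lemma labelLaw_cyl (p q : PMF (ℕ × ℕ)) (k : ℕ) (x : List ℕ → ℕ × ℕ) :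
    labelLaw p q (cyl k x) = ∏ v ∈ levels x k, (if v = [] then p else q) (x v) := by
  have hset : cyl k x = Set.pi (levels x k) fun v => {x v} := by
    ext y
    simp [cyl, Set.mem_pi]
  have : ∀ v : List ℕ, IsProbabilityMeasure (if v = [] then p else q).toMeasure := fun _ =>
    PMF.toMeasure.isProbabilityMeasure _
  rw [hset, labelLaw, Measure.infinitePi_pi _ fun _ _ => measurableSet_singleton _]
  refine Finset.prod_congr rfl fun v _ => ?_
  rw [PMF.toMeasure_apply_singleton _ _ (measurableSet_singleton _)]

instance (p q : PMF (ℕ × ℕ)) : IsProbabilityMeasure (labelLaw p q) := by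
  have : ∀ v : List ℕ, IsProbabilityMeasure (if v = [] then p else q).toMeasure := fun _ =>
    PMF.toMeasure.isProbabilityMeasure _
  unfold labelLaw
  infer_instance

/-! ### The unfolding of a configuration -/

section
variable {V : Type} {dout din : V → ℕ}

/-- The vertices met when the incoming half-edges are followed backwards from `i` along the words:
`vtx σ i (j :: v)` is the vertex at the other end of the in-half-edge number `j` of `vtx σ i v`. -/
def vtx (σ : Pairing dout din) (i : V) : List ℕ → V
  | [] => i
  | j :: v => if h : j < din (vtx σ i v) then (σ.symm ⟨vtx σ i v, ⟨j, h⟩⟩).1 else i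

/-- The labels (out-degree, in-degree) of the vertices of the unfolding. -/
def vtxLabel (σ : Pairing dout din) (i : V) (v : List ℕ) : ℕ × ℕ :=
  (dout (vtx σ i v), din (vtx σ i v))

/-- On the individuals of the unfolding the bound `h` always holds, so the default value `i` in
`vtx` plays no role there. -/
lemma vtx_cons {σ : Pairing dout din} {i : V} {j : ℕ} {v : List ℕ} (h : j < din (vtx σ i v)) :
    vtx σ i (j :: v) = (σ.symm ⟨vtx σ i v, ⟨j, h⟩⟩).1 := dif_pos h

lemma exists_vtx_cons {σ : Pairing dout din} {i : V} {j : ℕ} {v : List ℕ}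
    (h : j < din (vtx σ i v)) :
    ∃ a : Fin (dout (vtx σ i (j :: v))), σ ⟨vtx σ i (j :: v), a⟩ = ⟨vtx σ i v, ⟨j, h⟩⟩ := by
  rw [vtx_cons h]
  exact ⟨(σ.symm ⟨vtx σ i v, ⟨j, h⟩⟩).2, σ.apply_symm_apply _⟩

lemma vtx_cons_of_eq {σ : Pairing dout din} {i : V} {v : List ℕ} {u : V} {a : Fin (dout u)}
    {b : Fin (din (vtx σ i v))} (h : σ ⟨u, a⟩ = ⟨vtx σ i v, b⟩) : vtx σ i (b.1 :: v) = u := by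
  rw [vtx_cons b.2]
  have : σ.symm ⟨vtx σ i v, ⟨b.1, b.2⟩⟩ = ⟨u, a⟩ := σ.symm_apply_eq.2 h.symm
  rw [this]

variable [Fintype V] [DecidableEq V]

/-- The configuration `σ` rooted at `i`. -/
def rootedConfig (σ : Pairing dout din) (i : V) : RootedMarkedDigraph where
  V := V
  countable := inferInstance
  graph := configGraph σ
  root := i

lemma configGraph_mult_ne_zero {σ : Pairing dout din} {u w : V} :
    (configGraph σ).mult u w ≠ 0 ↔ ∃ (a : Fin (dout u)) (b : Fin (din w)), σ ⟨u, a⟩ = ⟨w, b⟩ := by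
  simp only [configGraph, ne_eq, Finset.card_eq_zero, ← Finset.nonempty_iff_ne_empty,
    Finset.Nonempty, Finset.mem_filter, Finset.mem_univ, true_and]
  refine exists_congr fun a => ⟨?_, ?_⟩
  · rintro rfl
    exact ⟨(σ ⟨u, a⟩).2, rfl⟩
  · rintro ⟨b, hb⟩
    rw [hb]

/-- The backward exploration visits exactly the image of the unfolding. No injectivity is needed
here; cycles only make several words name the same vertex. -/
lemma mem_found_rootedConfig (σ : Pairing dout din) (i : V) (k : ℕ)
    (u : (rootedConfig σ i).V) : u ∈ (rootedConfig σ i).found k ↔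
      ∃ v ∈ levels (vtxLabel σ i) k, vtx σ i v = u := by
  induction k generalizing u with
  | zero =>
    rw [mem_found_zero]
    simp only [levels, Finset.mem_singleton, exists_eq_left, vtx]
    exact eq_comm
  | succ k ih =>
    rw [mem_found_succ, ih]
    constructor
    · rintro (⟨v, hv, rfl⟩ | ⟨w, hw, h⟩)
      · exact ⟨v, levels_mono _ (Nat.le_succ k) hv, rfl⟩
      · obtain ⟨v, hv, rfl⟩ := (ih w).1 hw
        obtain ⟨a, b, hab⟩ := configGraph_mult_ne_zero (σ := σ) |>.1 h
        obtain ⟨h1, h2⟩ := mem_levels.1 hv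
        exact ⟨b.1 :: v, mem_levels.2 ⟨⟨h1, b.2⟩, Nat.succ_le_succ h2⟩, vtx_cons_of_eq hab⟩
    · rintro ⟨_ | ⟨j, v⟩, hv, rfl⟩
      · exact Or.inl ⟨[], nil_mem_levels _ _, rfl⟩
      · obtain ⟨⟨h1, h2⟩, h3⟩ := mem_levels.1 hv
        obtain ⟨a, ha⟩ := exists_vtx_cons (σ := σ) (i := i) (v := v) h2
        exact Or.inr ⟨vtx σ i v, (ih _).2 ⟨v, mem_levels.2 ⟨h1, Nat.le_of_succ_le_succ h3⟩, rfl⟩,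
          configGraph_mult_ne_zero (σ := σ) |>.2 ⟨a, _, ha⟩⟩

/-- Where the unfolding is injective up to generation `k + 1`, the `k`-neighbourhood in the
configuration is a tree. -/
lemma isomorphic_nbhd_rootedConfig {σ : Pairing dout din} {i : V} {k : ℕ}
    (hinj : Set.InjOn (vtx σ i) (levels (vtxLabel σ i) (k + 1))) :
    Isomorphic ((familyTree (vtxLabel σ i)).nbhd k) ((rootedConfig σ i).nbhd k) := by
  have hmem : ∀ v : (familyTree (vtxLabel σ i)).found k, v.1.1 ∈ levels (vtxLabel σ i) k :=
    fun v => mem_levels.2 ⟨v.1.2, (mem_found_familyTree _ _ _).1 v.2⟩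
  have hmem' : ∀ v : (familyTree (vtxLabel σ i)).found k,
      v.1.1 ∈ levels (vtxLabel σ i) (k + 1) := fun v => levels_mono _ (Nat.le_succ k) (hmem v)
  let φ : (familyTree (vtxLabel σ i)).found k → (rootedConfig σ i).found k := fun v =>
    ⟨vtx σ i v.1.1, (mem_found_rootedConfig σ i k _).2 ⟨v.1.1, hmem v, rfl⟩⟩
  have hφ : φ.Bijective := by
    constructor
    · intro v w h
      exact Subtype.ext (Subtype.ext (hinj (hmem' v) (hmem' w) (congrArg Subtype.val h)))
    · rintro ⟨u, hu⟩
      obtain ⟨v, hv, rfl⟩ := (mem_found_rootedConfig σ i k _).1 hu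
      obtain ⟨h1, h2⟩ := mem_levels.1 hv
      exact ⟨⟨⟨v, h1⟩, (mem_found_familyTree _ _ _).2 h2⟩, rfl⟩
  -- Every edge of the configuration inside the neighbourhood is an edge of the tree. An edge into
  -- the vertex of `v` names its source also by the word `b :: v`, which may lie in generation `k +
  -- 1`; this is why injectivity is assumed one generation deeper.
  have hchild : ∀ (u v : (familyTree (vtxLabel σ i)).found k) (a : Fin (dout (vtx σ i u.1.1)))
      (b : Fin (din (vtx σ i v.1.1))), σ ⟨vtx σ i u.1.1, a⟩ = ⟨vtx σ i v.1.1, b⟩ →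
      u.1.1 = b.1 :: v.1.1 := by
    intro u v a b hab
    refine hinj (hmem' u) ?_ (vtx_cons_of_eq hab).symm
    obtain ⟨h1, h2⟩ := mem_levels.1 (hmem v)
    exact mem_levels.2 ⟨⟨h1, b.2⟩, Nat.succ_le_succ h2⟩
  refine ⟨Equiv.ofBijective φ hφ, fun u v => ?_, rfl, fun v => ?_⟩
  · change (if k = 0 then 0 else (configGraph σ).mult (vtx σ i u.1.1) (vtx σ i v.1.1)) =
      if k = 0 then 0 else if u.1.1 ≠ [] ∧ u.1.1.tail = v.1.1 then 1 else 0
    congr 1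
    split_ifs with h
    · obtain ⟨⟨⟨_ | ⟨j, w⟩, hu⟩, hu'⟩, ⟨⟨v, hv⟩, hv'⟩⟩ := u, v
      · exact absurd rfl h.1
      · obtain rfl : w = v := h.2
        obtain ⟨a, ha⟩ := exists_vtx_cons (σ := σ) (i := i) (v := w) hu.2
        refine Finset.card_eq_one (s := Finset.univ.filter fun a : Fin (dout (vtx σ i (j :: w))) =>
          (σ ⟨_, a⟩).1 = vtx σ i w).2 ⟨a, ?_⟩
        ext a'
        simp only [Finset.mem_filter, Finset.mem_univ, true_and, Finset.mem_singleton]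
        constructor
        · intro ha'
          obtain ⟨b', hb'⟩ : ∃ b', σ ⟨vtx σ i (j :: w), a'⟩ = ⟨vtx σ i w, b'⟩ := by
            rw [← ha']
            exact ⟨_, rfl⟩
          -- A parallel edge would enter by the same in-half-edge `j`, so it is the same half-edge
          -- and the multiplicity is one.
          have hb := hchild ⟨⟨j :: w, hu⟩, hu'⟩ ⟨⟨w, hv⟩, hv'⟩ a' b' hb'
          have hj : j = b'.1 := (List.cons.inj hb).1
          have h3 : b' = ⟨j, hu.2⟩ := Fin.ext hj.symm
          rw [h3, ← ha] at hb'
          simpa using σ.injective hb'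
        · rintro rfl
          rw [ha]
    · by_contra hne
      obtain ⟨a, b, hab⟩ := configGraph_mult_ne_zero.1 hne
      have := hchild u v a b hab
      exact h (by simp [this])
  · change dout (vtx σ i v.1.1) = if v.1.1 = [] then dout (vtx σ i v.1.1)
      else max 1 (dout (vtx σ i v.1.1))
    obtain ⟨⟨_ | ⟨j, w⟩, hv⟩, hv'⟩ := v
    · rfl
    · obtain ⟨a, -⟩ := exists_vtx_cons (σ := σ) (i := i) (v := w) hv.2
      rw [if_neg (List.cons_ne_nil j w)]
      have := a.2
      simp only at this ⊢
      omega

end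

/-! ### The roots at which a given tree is seen -/

/-- The non-root individuals up to generation `k`, which index the edges of the tree. -/
abbrev TreeEdge (x : List ℕ → ℕ × ℕ) (k : ℕ) : Type := {v : levels x k // v.1 ≠ []}

/-- The parent of a non-root individual. -/
def TreeEdge.parent {x : List ℕ → ℕ × ℕ} {k : ℕ} (t : TreeEdge x k) : levels x k :=
  ⟨t.1.1.tail, by
    obtain ⟨⟨_ | ⟨j, v⟩, hv⟩, ht⟩ := t
    · exact absurd rfl ht
    · exact (cons_mem_levels hv).1⟩

/-- The birth number of a non-root individual. -/
def TreeEdge.slot {x : List ℕ → ℕ × ℕ} {k : ℕ} (t : TreeEdge x k) : ℕ := t.1.1.headI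

lemma TreeEdge.slot_lt {x : List ℕ → ℕ × ℕ} {k : ℕ} (t : TreeEdge x k) :
    t.slot < (x t.parent.1).2 := by
  obtain ⟨⟨_ | ⟨j, v⟩, hv⟩, ht⟩ := t
  · exact absurd rfl ht
  · exact (cons_mem_levels hv).2

lemma TreeEdge.parent_slot_injective {x : List ℕ → ℕ × ℕ} {k : ℕ} :
    Function.Injective fun t : TreeEdge x k => (t.parent, t.slot) := by
  rintro ⟨⟨_ | ⟨j, v⟩, hv⟩, ht⟩ ⟨⟨_ | ⟨j', v'⟩, hv'⟩, ht'⟩ h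
  · exact absurd rfl ht
  · exact absurd rfl ht
  · exact absurd rfl ht'
  · simp only [Prod.mk.injEq, Subtype.ext_iff, TreeEdge.parent, TreeEdge.slot, List.tail_cons,
      List.headI_cons] at h
    simp [h.1, h.2]

lemma card_levels_eq (x : List ℕ → ℕ × ℕ) (k : ℕ) :
    Fintype.card (levels x k) = Fintype.card (TreeEdge x k) + 1 := by
  have h := Fintype.card_subtype_compl fun v : levels x k => v.1 = []
  have h1 : Fintype.card {v : levels x k // v.1 = []} = 1 := by
    rw [Fintype.card_eq_one_iff]
    exact ⟨⟨⟨[], nil_mem_levels x k⟩, rfl⟩, fun v => Subtype.ext (Subtype.ext v.2)⟩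
  have h2 : 1 ≤ Fintype.card (levels x k) := by
    rw [← h1]
    exact Fintype.card_subtype_le _
  rw [h1] at h
  change Fintype.card (TreeEdge x k) = _ at h
  omega

section
variable {V : Type} {dout din : V → ℕ}

/-- Following numbered in-half-edges backwards is deterministic, so an embedding is determined by
the image of the root. -/
lemma vtx_eq_of_isEmbedding {σ : Pairing dout din} {k : ℕ} {x : List ℕ → ℕ × ℕ}
    {w : levels x k → V}
    (hw : IsEmbedding (fun u : levels x k => x u.1) (fun t : TreeEdge x k => t.1)
      TreeEdge.parent TreeEdge.slot σ w) (v : levels x k) :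
    vtx σ (w ⟨[], nil_mem_levels x k⟩) v.1 = w v := by
  obtain ⟨v, hv⟩ := v
  induction v with
  | nil => rfl
  | cons j v ih =>
    have hv' := (cons_mem_levels hv).1
    obtain ⟨a, b, hb, hab⟩ := hw.edge ⟨⟨j :: v, hv⟩, List.cons_ne_nil j v⟩
    change σ ⟨w ⟨j :: v, hv⟩, a⟩ = ⟨w ⟨v, hv'⟩, b⟩ at hab
    change b.1 = j at hb
    change Fin (din (w ⟨v, hv'⟩)) at b
    have hlt : j < din (vtx σ (w ⟨[], nil_mem_levels x k⟩) v) := by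
      rw [ih hv', ← hb]
      exact b.2
    rw [vtx_cons hlt]
    have : (⟨vtx σ (w ⟨[], nil_mem_levels x k⟩) v, ⟨j, hlt⟩⟩ : Σ u, Fin (din u)) =
        ⟨w ⟨v, hv'⟩, b⟩ := by
      rw [Sigma.mk.injEq]
      refine ⟨ih hv', (Fin.heq_ext_iff (by rw [ih hv'])).2 hb.symm⟩
    rw [this, σ.symm_apply_eq.2 hab.symm]

variable [Fintype V] [DecidableEq V]

open Classical in
/-- The vertices whose unfolding agrees with the family tree of `x`, and is injective, up to
generation `k`. -/
def matchedRoots (σ : Pairing dout din) (k : ℕ) (x : List ℕ → ℕ × ℕ) : Finset V :=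
  Finset.univ.filter fun i => vtxLabel σ i ∈ cyl k x ∧ Set.InjOn (vtx σ i) (levels x k)

lemma mem_matchedRoots {σ : Pairing dout din} {k : ℕ} {x : List ℕ → ℕ × ℕ} {i : V} :
    i ∈ matchedRoots σ k x ↔ vtxLabel σ i ∈ cyl k x ∧ Set.InjOn (vtx σ i) (levels x k) := by
  simp [matchedRoots]

lemma isomorphic_nbhd_of_mem_matchedRoots {σ : Pairing dout din} {k j : ℕ}
    {x : List ℕ → ℕ × ℕ} {i : V} (hi : i ∈ matchedRoots σ (k + 1) x) (hj : j ≤ k) :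
    Isomorphic ((rootedConfig σ i).nbhd j) ((familyTree x).nbhd j) := by
  obtain ⟨h1, h2⟩ := mem_matchedRoots.1 hi
  refine (isomorphic_nbhd_rootedConfig ?_).symm.trans
    (isomorphic_nbhd_familyTree h1 (hj.trans (Nat.le_succ k)))
  refine h2.mono ?_
  rw [← levels_eq_of_mem_cyl h1]
  exact_mod_cast levels_mono _ (Nat.succ_le_succ hj)

lemma disjoint_matchedRoots {σ : Pairing dout din} {k : ℕ} {x y : List ℕ → ℕ × ℕ}
    (h : Disjoint (cyl k x) (cyl k y)) :
    Disjoint (matchedRoots σ k x) (matchedRoots σ k y) :=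
  Finset.disjoint_left.2 fun _ hx hy =>
    Set.disjoint_left.1 h (mem_matchedRoots.1 hx).1 (mem_matchedRoots.1 hy).1

lemma card_embeddings_le_card_matchedRoots (σ : Pairing dout din) (k : ℕ)
    (x : List ℕ → ℕ × ℕ) :
    (embeddings (fun u : levels x k => x u.1) (fun t : TreeEdge x k => t.1)
      TreeEdge.parent TreeEdge.slot σ).card ≤ (matchedRoots σ k x).card := by
  classical
  refine Finset.card_le_card_of_injOn (fun w => w ⟨[], nil_mem_levels x k⟩) ?_ ?_
  · intro w hw
    replace hw := mem_embeddings.1 hw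
    rw [Finset.mem_coe, mem_matchedRoots]
    refine ⟨fun v hv => ?_, fun u hu v hv huv => ?_⟩
    · rw [vtxLabel, vtx_eq_of_isEmbedding hw ⟨v, hv⟩]
      exact hw.label ⟨v, hv⟩
    · rw [vtx_eq_of_isEmbedding hw ⟨u, hu⟩, vtx_eq_of_isEmbedding hw ⟨v, hv⟩] at huv
      exact congrArg Subtype.val (hw.injective huv)
  · intro w hw w' hw' h
    replace hw := mem_embeddings.1 hw
    replace hw' := mem_embeddings.1 hw'
    funext v
    rw [← vtx_eq_of_isEmbedding hw v, ← vtx_eq_of_isEmbedding hw' v]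
    exact congrArg (fun i => vtx σ i v.1) h

/-- A bound for the marks of the individuals up to generation `k`. -/
def markBound (k : ℕ) (x : List ℕ → ℕ × ℕ) : ℕ := 1 + ∑ v ∈ levels x k, (x v).1

/-- The root is recovered from `y` by walking forwards `v.length` steps. Each vertex passed has an
out-degree prescribed by `x`, so there are at most `markBound k x` choices per step, although the
out-degrees in the graph need not be bounded. -/
lemma card_matchedRoots_vtx_eq_le (σ : Pairing dout din) {k : ℕ} {x : List ℕ → ℕ × ℕ}
    {v : List ℕ} (hv : v ∈ levels x k) (y : V) :
    ((matchedRoots σ k x).filter fun i => vtx σ i v = y).card ≤ markBound k x ^ v.length := by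
  classical
  induction v generalizing y with
  | nil =>
    rw [List.length_nil, pow_zero, ← Finset.card_singleton y]
    refine Finset.card_le_card fun i hi => Finset.mem_singleton.2 (Finset.mem_filter.1 hi).2
  | cons j v ih =>
    obtain ⟨hv', hj⟩ := cons_mem_levels hv
    rcases ((matchedRoots σ k x).filter fun i => vtx σ i (j :: v) = y).eq_empty_or_nonempty
      with h0 | ⟨i₀, hi₀⟩
    · rw [h0, Finset.card_empty]
      exact Nat.zero_le _
    · have hdeg : dout y ≤ markBound k x := by
        obtain ⟨h1, rfl⟩ := Finset.mem_filter.1 hi₀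
        have h2 := congrArg Prod.fst ((mem_matchedRoots.1 h1).1 _ hv)
        change dout (vtx σ i₀ (j :: v)) = (x (j :: v)).1 at h2
        rw [h2]
        exact (Finset.single_le_sum (f := fun v => (x v).1) (fun _ _ => Nat.zero_le _) hv).trans
          (Nat.le_add_left _ _)
      have hsub : ((matchedRoots σ k x).filter fun i => vtx σ i (j :: v) = y) ⊆
          (Finset.univ : Finset (Fin (dout y))).biUnion fun a =>
            (matchedRoots σ k x).filter fun i => vtx σ i v = (σ ⟨y, a⟩).1 := by
        intro i hi
        obtain ⟨h1, rfl⟩ := Finset.mem_filter.1 hi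
        have h2 := congrArg Prod.snd ((mem_matchedRoots.1 h1).1 _ hv')
        change din (vtx σ i v) = (x v).2 at h2
        obtain ⟨a, ha⟩ := exists_vtx_cons (σ := σ) (i := i) (v := v) (j := j) (by rwa [h2])
        refine Finset.mem_biUnion.2 ⟨a, Finset.mem_univ _, Finset.mem_filter.2 ⟨h1, ?_⟩⟩
        rw [ha]
      refine (Finset.card_le_card hsub).trans ((Finset.card_biUnion_le_card_mul _ _ _
        fun a _ => ih hv' _).trans ?_)
      rw [Finset.card_univ, Fintype.card_fin, List.length_cons, pow_succ, mul_comm]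
      exact Nat.mul_le_mul_left _ hdeg

/-- The square of the number of matched roots is the number of embeddings of two disjoint copies of
the tree, up to an error of the order of the number of vertices. -/
lemma card_matchedRoots_sq_le (σ : Pairing dout din) (k : ℕ) (x : List ℕ → ℕ × ℕ) :
    (matchedRoots σ k x).card ^ 2 ≤
      (embeddings (fun u : Bool × levels x k => x u.2.1)
        (fun t : Bool × TreeEdge x k => (t.1, t.2.1))
        (fun t => (t.1, t.2.parent)) (fun t => t.2.slot) σ).card +
      (levels x k).card ^ 2 * (markBound k x ^ k * Fintype.card V) := by
  classical
  set I := matchedRoots σ k x with hI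
  -- Pairs of matched roots are split according to whether their trees share a vertex. The disjoint
  -- pairs are embeddings of the doubled tree; the overlapping ones, which include the diagonal, are
  -- counted crudely.
  let ov : V × V → Prop := fun p => ∃ u ∈ levels x k, ∃ v ∈ levels x k, vtx σ p.1 u = vtx σ p.2 v
  rw [sq, ← Finset.card_product, ← Finset.card_filter_add_card_filter_not (s := I ×ˢ I) ov,
    add_comm]
  refine add_le_add ?_ ?_
  · let r : V × V → Bool → V := fun p b => if b then p.1 else p.2
    refine Finset.card_le_card_of_injOn (fun p (u : Bool × levels x k) => vtx σ (r p u.1) u.2.1)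
      ?_ ?_
    · intro p hp
      obtain ⟨hp1, hp2⟩ := Finset.mem_filter.1 hp
      rw [Finset.mem_product] at hp1
      have hr : ∀ b, r p b ∈ I := by
        rintro (_ | _)
        · exact hp1.2
        · exact hp1.1
      refine mem_embeddings.2 ⟨?_, ?_, ?_⟩
      · rintro ⟨b, u⟩ ⟨b', u'⟩ h
        change vtx σ (r p b) u.1 = vtx σ (r p b') u'.1 at h
        obtain rfl : b = b' := by
          by_contra hne
          apply hp2
          rcases b with _ | _ <;> rcases b' with _ | _
          · exact absurd rfl hne
          · exact ⟨u'.1, u'.2, u.1, u.2, h.symm⟩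
          · exact ⟨u.1, u.2, u'.1, u'.2, h⟩
          · exact absurd rfl hne
        exact Prod.ext rfl (Subtype.ext ((mem_matchedRoots.1 (hr b)).2 u.2 u'.2 h))
      · rintro ⟨b, u⟩
        exact (mem_matchedRoots.1 (hr b)).1 u.1 u.2
      · rintro ⟨b, ⟨⟨_ | ⟨j, v⟩, hv⟩, ht⟩⟩
        · exact absurd rfl ht
        · obtain ⟨hv', hj⟩ := cons_mem_levels hv
          have h2 := congrArg Prod.snd ((mem_matchedRoots.1 (hr b)).1 _ hv')
          change din (vtx σ (r p b) v) = (x v).2 at h2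
          obtain ⟨a, ha⟩ := exists_vtx_cons (σ := σ) (i := r p b) (v := v) (j := j) (by rwa [h2])
          exact ⟨a, _, rfl, ha⟩
    · intro p _ p' _ h
      have h1 := congrFun h (true, ⟨[], nil_mem_levels x k⟩)
      have h2 := congrFun h (false, ⟨[], nil_mem_levels x k⟩)
      exact Prod.ext h1 h2
  · have hsub : (I ×ˢ I).filter ov ⊆ (levels x k ×ˢ levels x k).biUnion fun q =>
        (I ×ˢ I).filter fun p => vtx σ p.1 q.1 = vtx σ p.2 q.2 := by
      intro p hp
      obtain ⟨hp1, u, hu, v, hv, h⟩ := Finset.mem_filter.1 hp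
      exact Finset.mem_biUnion.2 ⟨(u, v), Finset.mk_mem_product hu hv,
        Finset.mem_filter.2 ⟨hp1, h⟩⟩
    refine (Finset.card_le_card hsub).trans ((Finset.card_biUnion_le_card_mul _ _
      (markBound k x ^ k * Fintype.card V) fun q hq => ?_).trans ?_)
    · obtain ⟨hq1, hq2⟩ := Finset.mem_product.1 hq
      -- The first root is free; given it, the meeting vertex is known and the second root has
      -- boundedly many positions. The summand `1` in `markBound` allows the exponent to be raised
      -- to `k`.
      refine (Finset.card_le_mul_card_image (f := Prod.fst) _ (markBound k x ^ k)
        fun i _ => ?_).trans (Nat.mul_le_mul_left _ (Finset.card_le_univ _))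
      refine le_trans ?_ ((card_matchedRoots_vtx_eq_le σ hq2 (vtx σ i q.1)).trans
        (Nat.pow_le_pow_right (by simp [markBound]) (mem_levels.1 hq2).2))
      refine Finset.card_le_card_of_injOn Prod.snd ?_ ?_
      · rintro ⟨i', j'⟩ hp
        obtain ⟨hp1, rfl⟩ := Finset.mem_filter.1 hp
        obtain ⟨hp2, hp3⟩ := Finset.mem_filter.1 hp1
        exact Finset.mem_filter.2 ⟨(Finset.mem_product.1 hp2).2, hp3.symm⟩
      · rintro p hp p' hp' h
        exact Prod.ext ((Finset.mem_filter.1 hp).2.trans (Finset.mem_filter.1 hp').2.symm) h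
    · rw [Finset.card_product, sq]

end

/-! ### Asymptotics of the first two moments -/

lemma tendsto_descFactorial_div_pow {a : ℕ → ℕ} {c : ℝ}
    (h : Tendsto (fun n => (a n : ℝ) / n) atTop (𝓝 c)) (m : ℕ) :
    Tendsto (fun n => ((a n).descFactorial m : ℝ) / (n : ℝ) ^ m) atTop (𝓝 (c ^ m)) := by
  induction m with
  | zero => simp
  | succ m ih =>
    -- Truncated subtraction is harmless: `a n - m` in `ℕ` lies between the real difference and `a
    -- n`.
    have h1 : Tendsto (fun n => ((a n - m : ℕ) : ℝ) / n) atTop (𝓝 c) := by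
      have h2 : Tendsto (fun n => (a n : ℝ) / n - m / n) atTop (𝓝 (c - 0)) :=
        h.sub (tendsto_const_div_atTop_nhds_zero_nat _)
      rw [sub_zero] at h2
      refine tendsto_of_tendsto_of_tendsto_of_le_of_le h2 h (fun n => ?_) fun n => ?_
      · simp only
        rw [← sub_div]
        gcongr
        rw [sub_le_iff_le_add]
        exact_mod_cast Nat.le_add_of_sub_le le_rfl
      · simp only
        gcongr
        exact Nat.sub_le _ _
    rw [pow_succ']
    refine (h1.mul ih).congr fun n => ?_
    rw [Nat.descFactorial_succ, Nat.cast_mul, pow_succ', mul_div_mul_comm]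

lemma card_injective {W V : Type} [Fintype W] [Fintype V]
    [DecidablePred fun w : W → V => w.Injective] [DecidableEq W] :
    (Finset.univ.filter fun w : W → V => w.Injective).card =
      (Fintype.card V).descFactorial (Fintype.card W) := by
  classical
  rw [← Fintype.card_embedding_eq, ← Fintype.card_subtype]
  exact Fintype.card_congr (Equiv.subtypeInjectiveEquivEmbedding W V)

section
variable {dout din : ∀ n : ℕ, Fin n → ℕ} {p : PMF (ℕ × ℕ)}

/-- Without injectivity the count is a product of sizes of label classes. At most `n ^ |W| -
(n)_|W|` maps fail to be injective, which is negligible against `n ^ |W|`. -/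
lemma tendsto_card_labelMaps (hreg : BidegreeRegular dout din p) {W : Type} [Fintype W]
    (x : W → ℕ × ℕ) :
    Tendsto (fun n : ℕ => ((labelMaps (dout n) (din n) x).card : ℝ) /
      (n : ℝ) ^ Fintype.card W) atTop (𝓝 (∏ u, (p (x u)).toReal)) := by
  classical
  let C : ∀ n, W → Finset (Fin n) := fun n u =>
    Finset.univ.filter fun i => (dout n i, din n i) = x u
  have hC : Tendsto (fun n : ℕ => ((Fintype.piFinset (C n)).card : ℝ) /
      (n : ℝ) ^ Fintype.card W) atTop (𝓝 (∏ u, (p (x u)).toReal)) := by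
    have h1 : Tendsto (fun n : ℕ => ∏ u, ((C n u).card : ℝ) / n) atTop
        (𝓝 (∏ u, (p (x u)).toReal)) := by
      refine tendsto_finsetProd _ fun u _ => ?_
      refine (hreg.tendsto_bidegree (x u).1 (x u).2).congr fun n => ?_
      simp only [C, Finset.sum_boole, Prod.ext_iff]
      ring
    refine h1.congr fun n => ?_
    rw [Fintype.card_piFinset, Nat.cast_prod, Finset.prod_div_distrib, Finset.prod_const,
      Finset.card_univ]
  have hmaps : ∀ n, labelMaps (dout n) (din n) x =
      (Fintype.piFinset (C n)).filter fun w => w.Injective := by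
    intro n
    ext w
    simp [labelMaps, C, and_comm]
  have hD : Tendsto (fun n : ℕ => 1 - ((n.descFactorial (Fintype.card W) : ℕ) : ℝ) /
      (n : ℝ) ^ Fintype.card W) atTop (𝓝 0) := by
    have h1 : Tendsto (fun n : ℕ => ((id n : ℕ) : ℝ) / (n : ℝ)) atTop (𝓝 1) := by
      refine tendsto_const_nhds.congr' ?_
      filter_upwards [eventually_ne_atTop 0] with n hn
      rw [id, div_self (Nat.cast_ne_zero.2 hn)]
    have h2 := tendsto_descFactorial_div_pow h1 (Fintype.card W)
    have h3 := h2.const_sub 1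
    rwa [one_pow, sub_self] at h3
  have hlow := hC.sub hD
  rw [sub_zero] at hlow
  refine tendsto_of_tendsto_of_tendsto_of_le_of_le' hlow hC ?_ ?_
  · filter_upwards [eventually_ne_atTop 0] with n hn
    have hn' : (0 : ℝ) < (n : ℝ) ^ Fintype.card W := by positivity
    have h1 := Finset.card_filter_add_card_filter_not (s := Fintype.piFinset (C n))
      fun w => w.Injective
    have h2 := Finset.card_filter_add_card_filter_not
      (s := (Finset.univ : Finset (W → Fin n))) fun w => w.Injective
    rw [card_injective, Finset.card_univ, Fintype.card_fun, Fintype.card_fin] at h2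
    have h3 : ((Fintype.piFinset (C n)).filter fun w => ¬ w.Injective).card ≤
        (Finset.univ.filter fun w : W → Fin n => ¬ w.Injective).card :=
      Finset.card_le_card (Finset.filter_subset_filter _ (Finset.subset_univ _))
    rw [hmaps, one_sub_div hn'.ne', ← sub_div]
    refine div_le_div_of_nonneg_right ?_ hn'.le
    have h4 : (Fintype.piFinset (C n)).card + n.descFactorial (Fintype.card W) ≤
        ((Fintype.piFinset (C n)).filter fun w => w.Injective).card + n ^ Fintype.card W := by
      omega
    have h5 : ((Fintype.piFinset (C n)).card : ℝ) + n.descFactorial (Fintype.card W) ≤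
        ((Fintype.piFinset (C n)).filter fun w => w.Injective).card +
          (n : ℝ) ^ Fintype.card W := by
      exact_mod_cast h4
    linarith
  · filter_upwards with n
    rw [hmaps]
    gcongr
    exact Finset.filter_subset _ _

lemma tendsto_sum_din (hreg : BidegreeRegular dout din p) :
    Tendsto (fun n => ((∑ i, din n i : ℕ) : ℝ) / n) atTop (𝓝 (meanOut p).toReal) := by
  rw [← hreg.meanIn_eq]
  refine hreg.tendsto_meanIn.congr fun n => ?_
  push_cast
  ring

lemma card_pairing_pos (hsum : ∀ n, ∑ i, dout n i = ∑ i, din n i) (n : ℕ) :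
    0 < Fintype.card (Pairing (dout n) (din n)) := by
  have : Fintype.card (Σ i, Fin (dout n i)) = Fintype.card (Σ i, Fin (din n i)) := by
    simp [hsum]
  exact Fintype.card_pos_iff.2 ⟨Fintype.equivOfCardEq this⟩

/-- The asymptotics of the expected number of embeddings of a pattern. -/
lemma tendsto_mean_embeddings (hreg : BidegreeRegular dout din p)
    (hsum : ∀ n, ∑ i, dout n i = ∑ i, din n i) {W T : Type} [Fintype W] [Fintype T]
    {x : W → ℕ × ℕ} {src tgt : T → W} {slot : T → ℕ} {r : ℕ}
    (hr : Fintype.card W = Fintype.card T + r)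
    (hsrc : src.Injective) (hslot : ∀ t, slot t < (x (tgt t)).2)
    (htgt : Function.Injective fun t => (tgt t, slot t)) :
    Tendsto (fun n : ℕ => (∑ σ : Pairing (dout n) (din n),
        ((embeddings x src tgt slot σ).card : ℝ)) /
        (Fintype.card (Pairing (dout n) (din n)) * (n : ℝ) ^ r)) atTop
      (𝓝 ((∏ u, (p (x u)).toReal) * ∏ t, ((x (src t)).1 / (meanOut p).toReal : ℝ))) := by
  have hμ : 0 < (meanOut p).toReal := ENNReal.toReal_pos hreg.meanOut_ne_zero hreg.meanOut_ne_top
  have hD := tendsto_descFactorial_div_pow (tendsto_sum_din hreg) (Fintype.card T)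
  -- The exact count is divided by `n ^ |W|` above and `n ^ |T|` below; by `hr` the quotient of
  -- these is `n ^ r`.
  have hlim := ((tendsto_card_labelMaps hreg x).mul_const (∏ t, ((x (src t)).1 : ℝ))).div hD
    (pow_pos hμ _).ne'
  rw [Finset.prod_div_distrib, Finset.prod_const, Finset.card_univ, ← mul_div_assoc]
  refine hlim.congr' ?_
  filter_upwards [eventually_ne_atTop 0, hD.eventually_const_lt (pow_pos hμ _)] with n hn hpos
  have hn' : (n : ℝ) ≠ 0 := Nat.cast_ne_zero.2 hn
  have hP : (Fintype.card (Pairing (dout n) (din n)) : ℝ) ≠ 0 :=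
    Nat.cast_ne_zero.2 (card_pairing_pos hsum n).ne'
  have hF : ((∑ i, din n i).descFactorial (Fintype.card T) : ℝ) ≠ 0 := by
    rintro h0
    rw [h0, zero_div] at hpos
    exact lt_irrefl _ hpos
  have key := congrArg (Nat.cast : ℕ → ℝ) (sum_card_embeddings_mul (dout := dout n) (din := din n)
    hsrc hslot htgt)
  push_cast at key hF ⊢
  simp only [Pi.div_apply]
  rw [hr, pow_add]
  field_simp
  linear_combination -key

end

section
variable {dout din : ∀ n : ℕ, Fin n → ℕ} {p : PMF (ℕ × ℕ)}

/-- Each non-root vertex is the source of exactly one tree edge. Its size-biasing factor is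
therefore the factor which that edge contributes to the expected number of embeddings. -/
lemma labelLaw_sizeBiasedOut_cyl (h0 : meanOut p ≠ 0) (htop : meanOut p ≠ ⊤) (k : ℕ)
    (x : List ℕ → ℕ × ℕ) :
    (labelLaw p (sizeBiasedOut p h0 htop)).real (cyl k x) =
      (∏ u : levels x k, (p (x u.1)).toReal) *
        ∏ t : TreeEdge x k, ((x t.1.1).1 / (meanOut p).toReal : ℝ) := by
  have h1 : ∏ t : TreeEdge x k, ((x t.1.1).1 / (meanOut p).toReal : ℝ) =
      ∏ u : levels x k, if u.1 ≠ [] then ((x u.1).1 / (meanOut p).toReal : ℝ) else 1 := by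
    rw [← Finset.prod_filter, ← Finset.prod_subtype_eq_prod_filter, Finset.subtype_univ]
  rw [Measure.real, labelLaw_cyl, ENNReal.toReal_prod, h1, ← Finset.prod_mul_distrib,
    ← Finset.prod_coe_sort]
  refine Finset.prod_congr rfl fun u _ => ?_
  by_cases hu : u.1 = []
  · simp [hu]
  · rw [if_neg hu, if_pos hu, sizeBiasedOut_apply, ENNReal.toReal_mul, ENNReal.toReal_mul,
      ENNReal.toReal_inv, ENNReal.toReal_natCast]
    ring

lemma pairingMeasure_le_ofReal (n : ℕ) {c : ℝ} (S : Set (Pairing (dout n) (din n)))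
    [DecidablePred (· ∈ S)] (hc : ((Finset.univ.filter (· ∈ S)).card : ℝ) /
      Fintype.card (Pairing (dout n) (din n)) ≤ c)
    (hpos : 0 < Fintype.card (Pairing (dout n) (din n))) :
    pairingMeasure (dout n) (din n) S ≤ ENNReal.ofReal c := by
  refine le_trans (le_of_eq ?_) (ENNReal.ofReal_le_ofReal hc)
  rw [pairingMeasure, ProbabilityTheory.uniformOn_univ, ENNReal.ofReal_div_of_pos
    (Nat.cast_pos.2 hpos), ENNReal.ofReal_natCast, ENNReal.ofReal_natCast]
  congr 1
  have : S = ((Finset.univ.filter (· ∈ S) : Finset (Pairing (dout n) (din n))) :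
      Set (Pairing (dout n) (din n))) := by
    ext
    simp
  conv_lhs => rw [this]
  rw [Measure.count_apply_finset' MeasurableSpace.measurableSet_top]

lemma chebyshev_pairing (hsum : ∀ n, ∑ i, dout n i = ∑ i, din n i) (n : ℕ)
    (Y : Pairing (dout n) (din n) → ℝ) {δ : ℝ} (hδ : 0 < δ) :
    pairingMeasure (dout n) (din n) {σ | δ ≤ |Y σ|} ≤
      ENNReal.ofReal ((∑ σ, Y σ ^ 2) / Fintype.card (Pairing (dout n) (din n)) / δ ^ 2) := by
  classical
  refine pairingMeasure_le_ofReal n _ ?_ (card_pairing_pos hsum n)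
  rw [le_div_iff₀ (by positivity), div_mul_eq_mul_div]
  gcongr
  rw [← nsmul_eq_mul]
  refine (Finset.card_nsmul_le_sum _ (fun σ => Y σ ^ 2) _ fun σ hσ => ?_).trans
    (Finset.sum_le_sum_of_subset_of_nonneg (Finset.subset_univ _) fun σ _ _ => sq_nonneg _)
  have hσ' : δ ≤ |Y σ| := (Finset.mem_filter.1 hσ).2
  rw [← sq_abs (Y σ)]
  gcongr

/-- The proportion of the vertices at which a given tree is seen converges in probability. -/
lemma tendsto_matchedRoots (hreg : BidegreeRegular dout din p)
    (hsum : ∀ n, ∑ i, dout n i = ∑ i, din n i) (k : ℕ) (x : List ℕ → ℕ × ℕ) {δ : ℝ} (hδ : 0 < δ) :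
    Tendsto (fun n => pairingMeasure (dout n) (din n) {σ | δ ≤
      |((matchedRoots σ k x).card : ℝ) / n -
        (labelLaw p (sizeBiasedOut p hreg.meanOut_ne_zero hreg.meanOut_ne_top)).real (cyl k x)|})
      atTop (𝓝 0) := by
  rw [labelLaw_sizeBiasedOut_cyl]
  set P := (∏ u : levels x k, (p (x u.1)).toReal) *
    ∏ t : TreeEdge x k, ((x t.1.1).1 / (meanOut p).toReal : ℝ) with hPdef
  have hE1 := tendsto_mean_embeddings hreg hsum (x := fun u : levels x k => x u.1)
    (src := fun t : TreeEdge x k => t.1) (tgt := TreeEdge.parent) (slot := TreeEdge.slot) (r := 1)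
    (card_levels_eq x k) Subtype.val_injective TreeEdge.slot_lt TreeEdge.parent_slot_injective
  have hE2 := tendsto_mean_embeddings hreg hsum (x := fun u : Bool × levels x k => x u.2.1)
    (src := fun t : Bool × TreeEdge x k => (t.1, t.2.1)) (tgt := fun t => (t.1, t.2.parent))
    (slot := fun t => t.2.slot) (r := 2)
    (by rw [Fintype.card_prod, Fintype.card_prod, card_levels_eq, Fintype.card_bool]; ring)
    (fun s t h => by
      rw [Prod.mk.injEq] at h
      exact Prod.ext h.1 (Subtype.val_injective h.2))
    (fun t => t.2.slot_lt)
    (fun s t h => by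
      simp only [Prod.mk.injEq] at h
      exact Prod.ext h.1.1 (TreeEdge.parent_slot_injective (Prod.ext h.1.2 h.2)))
  -- The doubled tree has two roots, whence `r = 2`, and its limit is the square.
  have hP2 : (∏ u : Bool × levels x k, (p (x u.2.1)).toReal) *
      ∏ t : Bool × TreeEdge x k, ((x t.2.1.1).1 / (meanOut p).toReal : ℝ) = P ^ 2 := by
    simp only [Fintype.prod_prod_type, Finset.prod_const, Finset.card_univ, Fintype.card_bool]
    rw [hPdef, mul_pow]
  simp only [hP2, ← hPdef] at hE1 hE2
  have hP0 : 0 ≤ P := by positivity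
  have hlim := (((hE2.add (tendsto_const_div_atTop_nhds_zero_nat
    (((levels x k).card ^ 2 * markBound k x ^ k : ℕ) : ℝ))).sub
    (hE1.const_mul (2 * P))).add_const (P ^ 2)).div_const (δ ^ 2)
  have hzero : (P ^ 2 + 0 - 2 * P * P + P ^ 2) / δ ^ 2 = 0 := by ring
  rw [hzero] at hlim
  have hlim' := ENNReal.tendsto_ofReal hlim
  rw [ENNReal.ofReal_zero] at hlim'
  refine tendsto_of_tendsto_of_tendsto_of_le_of_le' tendsto_const_nhds hlim'
    (Eventually.of_forall fun _ => zero_le) ?_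
  filter_upwards [eventually_ne_atTop 0] with n hn
  refine (chebyshev_pairing hsum n _ hδ).trans (ENNReal.ofReal_le_ofReal ?_)
  refine div_le_div_of_nonneg_right ?_ (sq_nonneg δ)
  have hn' : (0 : ℝ) < n := Nat.cast_pos.2 (Nat.pos_of_ne_zero hn)
  have hN : (0 : ℝ) < Fintype.card (Pairing (dout n) (din n)) :=
    Nat.cast_pos.2 (card_pairing_pos hsum n)
  set e1 : Pairing (dout n) (din n) → ℝ := fun σ =>
    ((embeddings (fun u : levels x k => x u.1) (fun t : TreeEdge x k => t.1)
      TreeEdge.parent TreeEdge.slot σ).card : ℝ)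
  set e2 : Pairing (dout n) (din n) → ℝ := fun σ =>
    ((embeddings (fun u : Bool × levels x k => x u.2.1)
        (fun t : Bool × TreeEdge x k => (t.1, t.2.1))
        (fun t => (t.1, t.2.parent)) (fun t => t.2.slot) σ).card : ℝ)
  set K : ℝ := (((levels x k).card ^ 2 * markBound k x ^ k : ℕ) : ℝ) with hK
  -- In the expansion of the square, the second moment needs only an upper bound and the first only
  -- a lower bound. This is what the two comparisons of matched roots with embeddings supply.
  have hpt : ∀ σ : Pairing (dout n) (din n), (((matchedRoots σ k x).card : ℝ) / n - P) ^ 2 ≤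
      e2 σ / (n : ℝ) ^ 2 + K / n - 2 * P * (e1 σ / n) + P ^ 2 := by
    intro σ
    have h1 : e1 σ ≤ (matchedRoots σ k x).card := by
      exact Nat.cast_le.2 (card_embeddings_le_card_matchedRoots σ k x)
    have h2 : ((matchedRoots σ k x).card : ℝ) ^ 2 ≤ e2 σ + K * n := by
      have := card_matchedRoots_sq_le σ k x
      rw [Fintype.card_fin, ← mul_assoc] at this
      have h := (Nat.cast_le (α := ℝ)).2 this
      rwa [Nat.cast_add, Nat.cast_mul _ n, Nat.cast_pow (matchedRoots σ k x).card] at h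
    have h3 : 2 * P * (e1 σ / n) ≤ 2 * P * (((matchedRoots σ k x).card : ℝ) / n) := by gcongr
    have h4 : ((matchedRoots σ k x).card : ℝ) ^ 2 / (n : ℝ) ^ 2 ≤
        e2 σ / (n : ℝ) ^ 2 + K / n := by
      refine (div_le_div_of_nonneg_right h2 (sq_nonneg _)).trans (le_of_eq ?_)
      field_simp
    rw [sub_sq, div_pow]
    linarith
  rw [div_le_iff₀ hN]
  refine (Finset.sum_le_sum fun σ _ => hpt σ).trans (le_of_eq ?_)
  simp only [Finset.sum_add_distrib, Finset.sum_sub_distrib, ← Finset.mul_sum, ← Finset.sum_div,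
    Finset.sum_const, Finset.card_univ, nsmul_eq_mul]
  field_simp

end

/-! ### From the probabilities of finite trees to bounded continuous functions -/

/-- Up to a small probability, the Galton–Watson tree is one of finitely many finite trees which
almost determine the value of a given continuous function. -/
lemma exists_finset_trees (μ : Measure (List ℕ → ℕ × ℕ)) [IsProbabilityMeasure μ]
    (f : LocalSpace →ᵇ ℝ) {η : ℝ} (hη : 0 < η) :
    ∃ (k : ℕ) (R : Finset (List ℕ → ℕ × ℕ)),
      (R : Set (List ℕ → ℕ × ℕ)).PairwiseDisjoint (cyl (k + 1)) ∧
      (∀ x ∈ R, ∀ G : RootedMarkedDigraph,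
        (∀ j ≤ k, Isomorphic (G.nbhd j) ((familyTree x).nbhd j)) →
        |f (SeparationQuotient.mk G) - f (SeparationQuotient.mk (familyTree x))| ≤ η) ∧
      1 - η ≤ ∑ x ∈ R, μ.real (cyl (k + 1) x) := by
  classical
  -- The trees whose neighbourhoods up to radius `k` determine `f` up to `η`. By continuity at each
  -- tree these sets increase to everything, so one of them has mass above `1 - η`. Cylinders are
  -- then taken at depth `k + 1`, the depth at which a matched root guarantees isomorphic
  -- `k`-neighbourhoods.
  let A : ℕ → Set (List ℕ → ℕ × ℕ) := fun k => {x | ∀ G : RootedMarkedDigraph,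
    (∀ j ≤ k, Isomorphic (G.nbhd j) ((familyTree x).nbhd j)) →
    |f (SeparationQuotient.mk G) - f (SeparationQuotient.mk (familyTree x))| ≤ η}
  have hmono : Monotone A := fun k l hkl x hx G hG => hx G fun j hj => hG j (hj.trans hkl)
  have hA : ⋃ k, A k = Set.univ := by
    refine Set.eq_univ_of_forall fun x => Set.mem_iUnion.2 ?_
    have hcont : Continuous fun G : RootedMarkedDigraph => f (SeparationQuotient.mk G) :=
      f.continuous.comp SeparationQuotient.continuous_mk
    obtain ⟨δ, hδ, h⟩ := Metric.continuousAt_iff.1 (hcont.continuousAt (x := familyTree x)) η hη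
    obtain ⟨k, hk⟩ := exists_nat_one_div_lt hδ
    refine ⟨k, fun G hG => (h ((locDist_lt hG).trans ?_)).le⟩
    rwa [add_comm]
  have h1 : ENNReal.ofReal (1 - η) < ⨆ k, μ (A k) := by
    rw [← hmono.measure_iUnion, hA, measure_univ, ENNReal.ofReal_lt_one]
    linarith
  obtain ⟨k, hk⟩ := lt_iSup_iff.1 h1
  have hcount : (cyl (k + 1) '' A k).Countable :=
    (countable_range_cyl (k + 1)).mono (Set.image_subset_range _ _)
  have hdisj : (cyl (k + 1) '' A k).Pairwise Disjoint := by
    rintro _ ⟨x, -, rfl⟩ _ ⟨y, -, rfl⟩ hne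
    refine Set.disjoint_left.2 fun z hzx hzy => hne ?_
    rw [← cyl_eq_of_mem hzx, cyl_eq_of_mem hzy]
  have hmeas : ∀ c ∈ cyl (k + 1) '' A k, MeasurableSet c := by
    rintro _ ⟨x, -, rfl⟩
    exact measurableSet_cyl _ _
  have h2 : ENNReal.ofReal (1 - η) < ∑' c : (cyl (k + 1) '' A k), μ c := by
    rw [← measure_sUnion hcount hdisj hmeas]
    refine hk.trans_le (measure_mono fun x hx => ?_)
    exact ⟨cyl (k + 1) x, ⟨x, hx, rfl⟩, self_mem_cyl _ _⟩
  rw [ENNReal.tsum_eq_iSup_sum] at h2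
  obtain ⟨s, hs⟩ := lt_iSup_iff.1 h2
  choose rep hrepA hrep using fun c : (cyl (k + 1) '' A k) => c.2
  have hinj : Function.Injective rep := fun c c' h => Subtype.ext (by rw [← hrep, ← hrep, h])
  refine ⟨k, s.image rep, ?_, ?_, ?_⟩
  · intro x hx y hy hne
    obtain ⟨c, -, rfl⟩ := Finset.mem_image.1 (Finset.mem_coe.1 hx)
    obtain ⟨c', -, rfl⟩ := Finset.mem_image.1 (Finset.mem_coe.1 hy)
    change Disjoint (cyl (k + 1) (rep c)) (cyl (k + 1) (rep c'))
    rw [hrep, hrep]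
    refine hdisj c.2 c'.2 fun h => hne ?_
    rw [Subtype.ext h]
  · intro x hx
    obtain ⟨c, -, rfl⟩ := Finset.mem_image.1 hx
    exact hrepA c
  · rw [Finset.sum_image hinj.injOn]
    simp only [hrep, Measure.real]
    rw [← ENNReal.toReal_sum fun _ _ => measure_ne_top _ _]
    exact (ENNReal.ofReal_le_iff_le_toReal (ENNReal.sum_ne_top.2 fun _ _ => measure_ne_top _ _)).1
      hs.le

/-- A point of one of the disjoint sets costs `η`; a point outside all of them costs `B`, and there
the last bracket is `1`. Integration of this bound gives the estimates for the tree and for the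
graph. -/
lemma abs_sub_sum_indicator_le {ι Y : Type*} {R : Finset ι} {C : ι → Set Y}
    (hC : (R : Set ι).PairwiseDisjoint C) {b : ι → ℝ} {g η B : ℝ} {y : Y} (hη : 0 ≤ η)
    (hb : ∀ x ∈ R, y ∈ C x → |g - b x| ≤ η) (hg : |g| ≤ B) :
    |g - ∑ x ∈ R, (C x).indicator (fun _ => b x) y| ≤
      η + B * (1 - ∑ x ∈ R, (C x).indicator (fun _ => (1 : ℝ)) y) := by
  by_cases h : ∃ x ∈ R, y ∈ C x
  · obtain ⟨x, hx, hy⟩ := h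
    have hne : ∀ x' ∈ R, x' ≠ x → y ∉ C x' := fun x' hx' hne hy' =>
      Set.disjoint_left.1 (hC hx' hx hne) hy' hy
    rw [Finset.sum_eq_single_of_mem x hx fun x' hx' hn =>
        Set.indicator_of_notMem (hne x' hx' hn) _,
      Finset.sum_eq_single_of_mem x hx fun x' hx' hn =>
        Set.indicator_of_notMem (hne x' hx' hn) _,
      Set.indicator_of_mem hy, Set.indicator_of_mem hy, sub_self, mul_zero, add_zero]
    exact hb x hx hy
  · push Not at h
    rw [Finset.sum_eq_zero fun x hx => Set.indicator_of_notMem (h x hx) _,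
      Finset.sum_eq_zero fun x hx => Set.indicator_of_notMem (h x hx) _]
    rw [sub_zero, sub_zero, mul_one]
    linarith

lemma abs_integral_sub_sum_le {ι Y : Type*} [MeasurableSpace Y] (μ : Measure Y)
    [IsProbabilityMeasure μ] {R : Finset ι} {C : ι → Set Y}
    (hC : (R : Set ι).PairwiseDisjoint C) (hmeas : ∀ x, MeasurableSet (C x)) {b : ι → ℝ}
    {g : Y → ℝ} {η B : ℝ} (hη : 0 ≤ η) (hgm : Integrable g μ)
    (hb : ∀ x ∈ R, ∀ y ∈ C x, |g y - b x| ≤ η) (hg : ∀ y, |g y| ≤ B) :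
    |∫ y, g y ∂μ - ∑ x ∈ R, μ.real (C x) * b x| ≤ η + B * (1 - ∑ x ∈ R, μ.real (C x)) := by
  have hind : ∀ (c : ι → ℝ), ∀ x ∈ R, Integrable ((C x).indicator fun _ => c x) μ :=
    fun c x _ => (integrable_const _).indicator (hmeas x)
  have hint : ∀ c : ι → ℝ, ∫ y, ∑ x ∈ R, (C x).indicator (fun _ => c x) y ∂μ =
      ∑ x ∈ R, μ.real (C x) * c x := by
    intro c
    rw [integral_finsetSum _ (hind c)]
    exact Finset.sum_congr rfl fun x _ => integral_indicator_const _ (hmeas x)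
  have h1 := hint fun _ => 1
  simp only [mul_one] at h1
  rw [← hint, ← integral_sub hgm (integrable_finsetSum _ (hind b))]
  have hsub : Integrable (fun y => 1 - ∑ x ∈ R, (C x).indicator (fun _ => (1 : ℝ)) y) μ :=
    (integrable_const _).sub (integrable_finsetSum _ (hind fun _ => 1))
  have hrhs : ∫ y, (η + B * (1 - ∑ x ∈ R, (C x).indicator (fun _ => (1 : ℝ)) y)) ∂μ =
      η + B * (1 - ∑ x ∈ R, μ.real (C x)) := by
    rw [integral_add (integrable_const _) (hsub.const_mul B), integral_const_mul,
      integral_sub (integrable_const _) (integrable_finsetSum _ (hind fun _ => 1)), h1]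
    simp
  rw [← hrhs]
  exact abs_integral_le_integral_abs.trans (integral_mono
    (hgm.sub (integrable_finsetSum _ (hind b))).abs ((integrable_const _).add (hsub.const_mul B))
    fun y => abs_sub_sum_indicator_le hC hη (fun x hx hy => hb x hx y hy) (hg y))

lemma abs_average_sub_sum_le {ι V : Type*} [Fintype V] [DecidableEq V] [Nonempty V] {R : Finset ι}
    {C : ι → Finset V} (hC : (R : Set ι).PairwiseDisjoint C) {b : ι → ℝ} {g : V → ℝ} {η B : ℝ}
    (hη : 0 ≤ η) (hb : ∀ x ∈ R, ∀ i ∈ C x, |g i - b x| ≤ η) (hg : ∀ i, |g i| ≤ B) :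
    |(∑ i, g i) / Fintype.card V - ∑ x ∈ R, ((C x).card : ℝ) / Fintype.card V * b x| ≤
      η + B * (1 - ∑ x ∈ R, ((C x).card : ℝ) / Fintype.card V) := by
  have hpos : (0 : ℝ) < Fintype.card V := Nat.cast_pos.2 Fintype.card_pos
  have hC' : (R : Set ι).PairwiseDisjoint fun x => (C x : Set V) := fun x hx y hy hne =>
    Finset.disjoint_coe.2 (hC hx hy hne)
  have hint : ∀ c : ι → ℝ, ∑ i, ∑ x ∈ R, (C x : Set V).indicator (fun _ => c x) i =
      ∑ x ∈ R, ((C x).card : ℝ) * c x := by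
    intro c
    rw [Finset.sum_comm]
    refine Finset.sum_congr rfl fun x _ => ?_
    simp [Set.indicator_apply]
  have h1 := hint fun _ => 1
  simp only [mul_one] at h1
  have hsum : |∑ i, g i - ∑ x ∈ R, ((C x).card : ℝ) * b x| ≤
      ∑ i : V, (η + B * (1 - ∑ x ∈ R, (C x : Set V).indicator (fun _ => (1 : ℝ)) i)) := by
    rw [← hint, ← Finset.sum_sub_distrib]
    exact (Finset.abs_sum_le_sum_abs _ _).trans (Finset.sum_le_sum fun i _ =>
      abs_sub_sum_indicator_le hC' hη (fun x hx hy => hb x hx i hy) (hg i))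
  rw [Finset.sum_add_distrib, ← Finset.mul_sum, Finset.sum_sub_distrib, h1] at hsum
  simp only [Finset.sum_const, Finset.card_univ, nsmul_eq_mul, mul_one] at hsum
  have h2 : (∑ i, g i) / Fintype.card V - ∑ x ∈ R, ((C x).card : ℝ) / Fintype.card V * b x =
      (∑ i, g i - ∑ x ∈ R, ((C x).card : ℝ) * b x) / Fintype.card V := by
    rw [sub_div, Finset.sum_div R]
    congr 1
    exact Finset.sum_congr rfl fun x _ => by ring
  rw [h2, abs_div, abs_of_pos hpos, div_le_iff₀ hpos, ← Finset.sum_div]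
  refine hsum.trans (le_of_eq ?_)
  field_simp

lemma stronglyMeasurable_boundedContinuous (f : LocalSpace →ᵇ ℝ) : StronglyMeasurable f :=
  f.continuous.measurable.stronglyMeasurable

lemma integral_rootLaw {V : Type} [Fintype V] (G : MarkedDigraph V) (f : LocalSpace →ᵇ ℝ) :
    ∫ y, f y ∂G.rootLaw = (∑ i, f (G.rootedAt i)) / Fintype.card V := by
  rw [MarkedDigraph.rootLaw, integral_smul_measure,
    integral_finsetSum_measure fun i _ => f.integrable (Measure.dirac (G.rootedAt i)),
    Finset.sum_congr rfl fun i _ =>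
      integral_dirac' f (G.rootedAt i) (stronglyMeasurable_boundedContinuous f),
    ENNReal.toReal_inv, ENNReal.toReal_natCast, smul_eq_mul, div_eq_inv_mul]

lemma integral_galtonWatsonLaw (p q : PMF (ℕ × ℕ)) (f : LocalSpace →ᵇ ℝ) :
    ∫ y, f y ∂galtonWatsonLaw p q =
      ∫ x, f (SeparationQuotient.mk (familyTree x)) ∂labelLaw p q :=
  integral_map measurable_mk_familyTree.aemeasurable
    (stronglyMeasurable_boundedContinuous f).aestronglyMeasurable

instance (p q : PMF (ℕ × ℕ)) : IsProbabilityMeasure (galtonWatsonLaw p q) :=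
  Measure.isProbabilityMeasure_map measurable_mk_familyTree.aemeasurable

end DirectedLW

end

theorem proposition6p2 (dout din : ∀ n : ℕ, Fin n → ℕ)
    (hsum : ∀ n, ∑ i, dout n i = ∑ i, din n i)
    (p : PMF (ℕ × ℕ)) (hreg : DirectedLW.BidegreeRegular dout din p) :
    DirectedLW.ConvergesInProbability
      (fun n => DirectedLW.pairingMeasure (dout n) (din n))
      (fun _ σ => DirectedLW.configGraph σ)
      (DirectedLW.galtonWatsonLaw p
        (DirectedLW.sizeBiasedOut p hreg.meanOut_ne_zero hreg.meanOut_ne_top)) := by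
  open DirectedLW in
  refine ⟨inferInstance, fun f ε hε => ?_⟩
  set μ := labelLaw p (sizeBiasedOut p hreg.meanOut_ne_zero hreg.meanOut_ne_top) with hμ
  have hB : 0 ≤ ‖f‖ := norm_nonneg f
  set B := ‖f‖ with hBdef
  obtain ⟨k, R, hdisj, hosc, hmass⟩ := exists_finset_trees μ f
    -- The error is at most `2 η (B + 1) + 2 |R| δ B`. The choices of `η` and `δ` bound these terms
    -- by `ε / 2` and `ε / 4`.
    (η := ε / (4 * (B + 1))) (by positivity)
  set η := ε / (4 * (B + 1)) with hηdef
  have hη : 0 < η := by positivity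
  set δ := ε / (8 * (B + 1) * (R.card + 1)) with hδdef
  have hδ : 0 < δ := by positivity
  have hlim : Tendsto (fun n => ∑ x ∈ R, pairingMeasure (dout n) (din n) {σ | δ ≤
      |((matchedRoots σ (k + 1) x).card : ℝ) / n - μ.real (cyl (k + 1) x)|}) atTop (𝓝 0) := by
    have h := tendsto_finsetSum R fun x _ => tendsto_matchedRoots hreg hsum (k + 1) x hδ
    rwa [Finset.sum_const_zero] at h
  refine tendsto_of_tendsto_of_tendsto_of_le_of_le' tendsto_const_nhds hlim
    (Eventually.of_forall fun _ => zero_le) ?_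
  filter_upwards [eventually_gt_atTop 0] with n hn
  -- If every proportion is within `δ` of its limit, the two integrals differ by less than `ε`; so
  -- the bad event lies in a finite union of rare events.
  refine (measure_mono ?_).trans (measure_biUnion_finset_le R _)
  intro σ hσ
  by_contra hcon
  simp only [Set.mem_iUnion, Set.mem_ofPred_eq, not_exists, not_le] at hcon
  have hσ' : ε ≤ |∫ x, f x ∂(configGraph σ).rootLaw -
    ∫ x, f x ∂galtonWatsonLaw p (sizeBiasedOut p hreg.meanOut_ne_zero hreg.meanOut_ne_top)| := hσ
  rw [integral_rootLaw, integral_galtonWatsonLaw, ← hμ] at hσ'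
  have : Nonempty (Fin n) := ⟨⟨0, hn⟩⟩
  let b : (List ℕ → ℕ × ℕ) → ℝ := fun x => f (SeparationQuotient.mk (familyTree x))
  have hbB : ∀ x, |b x| ≤ B := fun x => f.norm_coe_le_norm _
  have hT := abs_integral_sub_sum_le μ hdisj (fun x => measurableSet_cyl (k + 1) x) (b := b)
    (g := b) (η := η) (B := B) hη.le
    (Integrable.of_bound (f.continuous.comp continuous_mk_familyTree).aestronglyMeasurable B
      (Eventually.of_forall hbB))
    (fun x hx y hy => hosc x hx _ fun j hj =>
      isomorphic_nbhd_familyTree hy (hj.trans (Nat.le_succ k))) hbB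
  have hG := abs_average_sub_sum_le (R := R) (C := fun x => matchedRoots σ (k + 1) x)
    (fun x hx y hy hne => disjoint_matchedRoots (hdisj hx hy hne)) (b := b)
    (g := fun i => f ((configGraph σ).rootedAt i)) (η := η) (B := B) hη.le
    (fun x hx i hi => hosc x hx (rootedConfig σ i) fun j hj =>
      isomorphic_nbhd_of_mem_matchedRoots hi hj) (fun i => f.norm_coe_le_norm _)
  rw [Fintype.card_fin] at hG hσ'
  have hclose : |∑ x ∈ R, ((matchedRoots σ (k + 1) x).card : ℝ) / n * b x -
      ∑ x ∈ R, μ.real (cyl (k + 1) x) * b x| ≤ R.card * (δ * B) := by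
    rw [← Finset.sum_sub_distrib, ← nsmul_eq_mul]
    refine (Finset.abs_sum_le_sum_abs _ _).trans (Finset.sum_le_card_nsmul _ _ _ fun x hx => ?_)
    rw [← sub_mul, abs_mul]
    exact mul_le_mul (hcon x hx).le (hbB x) (abs_nonneg _) hδ.le
  -- The proportion of unmatched vertices is controlled through the limit: the cylinders nearly
  -- exhaust the tree law, and the matched proportions are close to their masses.
  have hcount : 1 - ∑ x ∈ R, ((matchedRoots σ (k + 1) x).card : ℝ) / n ≤ η + R.card * δ := by
    have h1 : |∑ x ∈ R, ((matchedRoots σ (k + 1) x).card : ℝ) / n -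
        ∑ x ∈ R, μ.real (cyl (k + 1) x)| ≤ R.card * δ := by
      rw [← Finset.sum_sub_distrib, ← nsmul_eq_mul]
      exact (Finset.abs_sum_le_sum_abs _ _).trans
        (Finset.sum_le_card_nsmul _ _ _ fun x hx => (hcon x hx).le)
    have h2 := (abs_le.1 h1).1
    linarith
  have hG' := hG.trans (add_le_add_right (mul_le_mul_of_nonneg_left hcount hB) η)
  have hT' := hT.trans (add_le_add_right (mul_le_mul_of_nonneg_left
    (sub_le_comm.1 hmass) hB) η)
  have hηε : η * (B + 1) = ε / 4 := by
    rw [hηdef]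
    field_simp
  have hδε : δ * (B + 1) * (R.card + 1) = ε / 8 := by
    rw [hδdef]
    field_simp
  have hRδ : R.card * (δ * B) ≤ ε / 8 := by
    rw [← hδε]
    nlinarith [mul_nonneg hδ.le hB, (Nat.cast_nonneg R.card : (0 : ℝ) ≤ R.card),
      mul_nonneg hδ.le (Nat.cast_nonneg R.card : (0 : ℝ) ≤ R.card)]
  have htri := abs_le.1 hG'
  have htri2 := abs_le.1 hT'
  have htri3 := abs_le.1 hclose
  have hBη : B * (η + R.card * δ) = B * η + R.card * (δ * B) := by ring
  rw [hBη] at htri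
  refine absurd hσ' (not_le.2 (abs_lt.2 ⟨?_, ?_⟩)) <;> nlinarith
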